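/- Let $\mathcal H$ be a complex Hilbert space, $\mathcal A\subset\mathcal B(\mathcal H)$ a von Neumann algebra, and let $\mathcal P_{\mathcal A}$ be the manifold of orthogonal projections of $\mathcal A$. For projections $p,q\in\mathcal P_{\mathcal A}$ write $p^\perp=1-p$, let $p\wedge q$ be the orthogonal projection onto $R(p)\cap R(q)$, and write $e\sim f$ if there is $v\in\mathcal A$ with $v^*v=e$ and $vv^*=f$ (Murray--von Neumann equivalence). The covariant derivative of a vector field $X(t)$ tangent to $\mathcal P_{\mathcal A}$ along a curve $\gamma(t)$ in $\mathcal P_{\mathcal A}$ is the co-diagonal part of $\dot X(t)$ with respect to $\gamma(t)$, namely $\gamma\dot X\gamma^\perp+\gamma^\perp\dot X\gamma$. A geodesic of $\mathcal P_{\mathcal A}$ is a smooth curve $\delta:\mathbb R\to\mathcal P_{\mathcal A}$ whose velocity $\dot\delta$ has zero covariant derivative along $\delta$; it joins $p$ and $q$ if $\delta(0)=p$ and $\delta(1)=q$, and it is normalized if $\|\dot\delta(0)\|\le\pi/2$ (operator norm). The length of a $C^1$ curve $\gamma:[a,b]\to\mathcal P_{\mathcal A}$ is $\int_a^b\|\dot\gamma(t)\|\,dt$.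 **Theorem.** Let $p,q\in\mathcal P_{\mathcal A}$. 1. There exists a geodesic of $\mathcal P_{\mathcal A}$ joining $p$ and $q$ if and only if $p\wedge q^\perp\sim p^\perp\wedge q$. Moreover, in this case the geodesic $\delta$ can be chosen normalized and minimal, i.e. such that the length of $\delta|_{[0,1]}$ is at most the length of any $C^1$ curve in $\mathcal P_{\mathcal A}$ with endpoints $p$ and $q$. 2. There exists a unique normalized geodesic of $\mathcal P_{\mathcal A}$ joining $p$ and $q$ if and only if $p\wedge q^\perp=p^\perp\wedge q=0$. -/

import Mathlib

open scoped ContDiff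

/-- The set of orthogonal projections of the von Neumann algebra `A ⊆ B(H)`. -/
def projectionSet {H : Type*} [NormedAddCommGroup H] [InnerProductSpace ℂ H] [CompleteSpace H]
    (A : VonNeumannAlgebra H) : Set (H →L[ℂ] H) :=
  {p | p ∈ A ∧ IsStarProjection p}

/-- The infimum `p ∧ q` of two projections: the orthogonal projection onto `R(p) ∩ R(q)`.
For projections this intersection is already closed (see `range_projInf`); the closure is written
only so that the orthogonal projection makes sense for arbitrary operators. -/
noncomputable def projInf {H : Type*} [NormedAddCommGroup H] [InnerProductSpace ℂ H]
    [CompleteSpace H] (p q : H →L[ℂ] H) : H →L[ℂ] H :=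
  (p.range ⊓ q.range).topologicalClosure.starProjection

theorem range_projInf {H : Type*} [NormedAddCommGroup H] [InnerProductSpace ℂ H]
    [CompleteSpace H] {p q : H →L[ℂ] H} (hp : IsStarProjection p) (hq : IsStarProjection q) :
    (projInf p q).range = p.range ⊓ q.range := by
  have h1 := ContinuousLinearMap.IsIdempotentElem.isClosed_range hp.isIdempotentElem
  have h2 := ContinuousLinearMap.IsIdempotentElem.isClosed_range hq.isIdempotentElem
  have h : IsClosed ((p.range ⊓ q.range : Submodule ℂ H) : Set H) := h1.inter h2
  unfold projInf
  rw [Submodule.range_starProjection, h.submodule_topologicalClosure_eq]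

/-- Murray--von Neumann equivalence of projections relative to `A`:
there is `v ∈ A` with `v* v = e` and `v v* = f`. -/
def MvNEquiv {H : Type*} [NormedAddCommGroup H] [InnerProductSpace ℂ H] [CompleteSpace H]
    (A : VonNeumannAlgebra H) (e f : H →L[ℂ] H) : Prop :=
  ∃ v ∈ A, star v * v = e ∧ v * star v = f

/-- The covariant derivative of a vector field `X` along a curve `γ` of projections: the
co-diagonal part of `X'(t)` with respect to `γ(t)`, that is, its component tangent at `γ(t)` to
the manifold of projections (the tangent vectors at `p` are the selfadjoint `x` with
`x = p x + x p`). -/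
noncomputable def covariantDeriv {H : Type*} [NormedAddCommGroup H] [InnerProductSpace ℂ H]
    [CompleteSpace H] (γ X : ℝ → H →L[ℂ] H) (t : ℝ) : H →L[ℂ] H :=
  γ t * deriv X t * (1 - γ t) + (1 - γ t) * deriv X t * γ t

/-- Geodesics of the manifold of projections of `A`: smooth curves of projections of `A`
whose velocity is parallel. -/
structure IsGeodesic {H : Type*} [NormedAddCommGroup H] [InnerProductSpace ℂ H]
    [CompleteSpace H] (A : VonNeumannAlgebra H) (δ : ℝ → H →L[ℂ] H) : Prop where
  smooth : ContDiff ℝ ∞ δ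
  mem : ∀ t, δ t ∈ projectionSet A
  parallel : ∀ t, covariantDeriv δ (deriv δ) t = 0

/-- `δ` is a geodesic of projections of `A` with `δ 0 = p` and `δ 1 = q`. -/
structure IsGeodesicJoining {H : Type*} [NormedAddCommGroup H] [InnerProductSpace ℂ H]
    [CompleteSpace H] (A : VonNeumannAlgebra H) (p q : H →L[ℂ] H) (δ : ℝ → H →L[ℂ] H) : Prop where
  geodesic : IsGeodesic A δ
  source : δ 0 = p
  target : δ 1 = q

/-- `δ` is normalized: its initial speed, in the operator norm, is at most `π / 2`. -/
def IsNormalizedCurve {H : Type*} [NormedAddCommGroup H] [InnerProductSpace ℂ H]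
    [CompleteSpace H] (δ : ℝ → H →L[ℂ] H) : Prop :=
  ‖deriv δ 0‖ ≤ Real.pi / 2

/-- Length of the curve `γ` on `[a, b]` for the Finsler metric given by the operator norm. -/
noncomputable def curveLength {H : Type*} [NormedAddCommGroup H] [InnerProductSpace ℂ H]
    [CompleteSpace H] (γ : ℝ → H →L[ℂ] H) (a b : ℝ) : ℝ :=
  ∫ t in a..b, ‖derivWithin γ (Set.Icc a b) t‖

/-- `δ` on `[0, 1]` has minimal length among all continuously differentiable curves of projections
of `A` with the same endpoints (in particular among all smooth ones). -/
def IsLengthMinimizing {H : Type*} [NormedAddCommGroup H] [InnerProductSpace ℂ H]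
    [CompleteSpace H] (A : VonNeumannAlgebra H) (δ : ℝ → H →L[ℂ] H) : Prop :=
  ∀ (γ : ℝ → H →L[ℂ] H) (a b : ℝ), a < b → ContDiffOn ℝ 1 γ (Set.Icc a b) →
    (∀ t ∈ Set.Icc a b, γ t ∈ projectionSet A) → γ a = δ 0 → γ b = δ 1 →
    curveLength δ 0 1 ≤ curveLength γ a b

section CStarAlgebra

variable {𝔄 : Type*} [CStarAlgebra 𝔄]

theorem exp_add_exp_neg_congr {x y : 𝔄} (h : x * x = y * y) :
    NormedSpace.exp x + NormedSpace.exp (-x) = NormedSpace.exp y + NormedSpace.exp (-y) := by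
  have key (u : 𝔄) : HasSum (fun n : ℕ => ((n.factorial : ℂ)⁻¹) • (u ^ n + (-u) ^ n))
      (NormedSpace.exp u + NormedSpace.exp (-u)) := by
    simpa [smul_add] using (NormedSpace.exp_series_hasSum_exp' (𝕂 := ℂ) u).add
      (NormedSpace.exp_series_hasSum_exp' (𝕂 := ℂ) (-u))
  refine (key x).unique ?_
  convert key y using 2 with n
  rcases n.even_or_odd with hn | hn
  · rw [hn.neg_pow, hn.neg_pow]
    obtain ⟨k, rfl⟩ := hn
    have (u : 𝔄) : u ^ (k + k) = (u * u) ^ k := by rw [← pow_two, ← pow_mul, two_mul]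
    simp only [this, h]
  · rw [hn.neg_pow, hn.neg_pow]
    simp

theorem exp_sub_exp_neg_mul {s x y : 𝔄} (hx : x = s * y) (h : x * x = y * y) :
    NormedSpace.exp x - NormedSpace.exp (-x) =
      s * (NormedSpace.exp y - NormedSpace.exp (-y)) := by
  have key (u : 𝔄) : HasSum (fun n : ℕ => ((n.factorial : ℂ)⁻¹) • (u ^ n - (-u) ^ n))
      (NormedSpace.exp u - NormedSpace.exp (-u)) := by
    simpa [smul_sub] using (NormedSpace.exp_series_hasSum_exp' (𝕂 := ℂ) u).sub
      (NormedSpace.exp_series_hasSum_exp' (𝕂 := ℂ) (-u))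
  have hterm (n : ℕ) : ((n.factorial : ℂ)⁻¹) • (x ^ n - (-x) ^ n) =
      s * (((n.factorial : ℂ)⁻¹) • (y ^ n - (-y) ^ n)) := by
    rw [mul_smul_comm]
    congr 1
    rcases n.even_or_odd with hn | hn
    · rw [hn.neg_pow, hn.neg_pow]
      simp
    · rw [hn.neg_pow, hn.neg_pow]
      obtain ⟨k, rfl⟩ := hn
      have (u : 𝔄) : u ^ (2 * k + 1) = u * (u * u) ^ k := by
        rw [pow_succ', pow_mul, pow_two]
      simp only [this, h, sub_neg_eq_add, mul_add]
      rw [hx, mul_assoc]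
  have hy := (key y).mul_left s
  simp only [← hterm] at hy
  exact (key x).unique hy

theorem exp_I_smul_eq_cos_add_sin {x : 𝔄} (hx : IsSelfAdjoint x) :
    NormedSpace.exp (Complex.I • x) = cfc Real.cos x + Complex.I • cfc Real.sin x := by
  have hn : IsStarNormal x := hx.isStarNormal
  have hI : IsStarNormal (Complex.I • x) := by
    constructor
    simp [Commute, SemiconjBy, hx.star_eq]
  rw [← CFC.complex_exp_eq_normedSpace_exp (a := Complex.I • x) hI, ← cfc_comp_smul Complex.I _ x,
    cfc_real_eq_complex _ hx, cfc_real_eq_complex _ hx, ← cfc_const_mul .., ← cfc_add ..]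
  refine cfc_congr fun z hz => ?_
  obtain ⟨r, rfl⟩ : ∃ r : ℝ, z = r := ⟨z.re, by
    simpa using hx.mem_spectrum_eq_re hz⟩
  simp [mul_comm Complex.I, Complex.exp_mul_I]

theorem exp_neg_I_smul_eq_cos_sub_sin {x : 𝔄} (hx : IsSelfAdjoint x) :
    NormedSpace.exp (-(Complex.I • x)) = cfc Real.cos x - Complex.I • cfc Real.sin x := by
  rw [← smul_neg, exp_I_smul_eq_cos_add_sin hx.neg, ← cfc_comp_neg .., ← cfc_comp_neg ..]
  simp [cfc_neg, sub_eq_add_neg]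

/-- Euler's formula, with the imaginary unit replaced by a symmetry anticommuting with `x`. -/
theorem exp_mul_eq_cos_add_mul_sin {s x : 𝔄} (hx : IsSelfAdjoint x) (hs : s * s = 1)
    (hsx : s * x = -(x * s)) :
    NormedSpace.exp (s * x) = cfc Real.cos x + s * cfc Real.sin x := by
  have hsq : s * x * (s * x) = (Complex.I • x) * (Complex.I • x) := by
    have : s * x * (s * x) = -(x * (s * s) * x) := by
      conv_lhs => enter [1]; rw [hsx]
      noncomm_ring
    rw [this, hs, smul_mul_smul_comm]
    simp
  have h1 := exp_add_exp_neg_congr hsq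
  have h2 := exp_sub_exp_neg_mul (s := -(Complex.I • s)) (x := s * x) (y := Complex.I • x)
    (by simp [smul_smul]) hsq
  rw [exp_I_smul_eq_cos_add_sin hx, exp_neg_I_smul_eq_cos_sub_sin hx] at h1 h2
  have h3 : -(Complex.I • s) * ((cfc Real.cos x + Complex.I • cfc Real.sin x) -
      (cfc Real.cos x - Complex.I • cfc Real.sin x)) = (2 : ℂ) • (s * cfc Real.sin x) := by
    rw [show (cfc Real.cos x + Complex.I • cfc Real.sin x) -
      (cfc Real.cos x - Complex.I • cfc Real.sin x) = (2 * Complex.I) • cfc Real.sin x by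
        module]
    rw [← neg_smul, smul_mul_smul_comm]
    congr 1
    linear_combination (-2) * Complex.I_mul_I
  rw [h3] at h2
  have h4 : (2 : ℂ) • NormedSpace.exp (s * x) = (2 : ℂ) • (cfc Real.cos x + s * cfc Real.sin x) := by
    linear_combination (norm := module) h1 + h2
  exact smul_right_injective 𝔄 (two_ne_zero' ℂ) h4

theorem mul_cfc_of_anticommute {s x : 𝔄} (hx : IsSelfAdjoint x) (hss : IsSelfAdjoint s)
    (hs : s * s = 1) (hsx : s * x = -(x * s)) {f : ℝ → ℝ} (hf : Continuous f)
    (hodd : ∀ t, f (-t) = -f t) : s * cfc f x = -(cfc f x * s) := by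
  let u : unitary 𝔄 := ⟨s, by simp [Unitary.mem_iff, hss.star_eq, hs]⟩
  have h := StarAlgHomClass.map_cfc (S := ℂ) (Unitary.conjStarAlgAut ℂ 𝔄 u) f x (hφ := by
    have : Continuous fun y : 𝔄 => (u : 𝔄) * y * (star u : unitary 𝔄) := by fun_prop
    exact this) (hφa := hx.map _)
  simp only [Unitary.conjStarAlgAut_apply] at h
  have hu : (u : 𝔄) * x * (star u : unitary 𝔄) = -x := by
    change s * x * star s = -x
    rw [hsx, hss.star_eq, neg_mul, mul_assoc, hs, mul_one]
  have h' : s * cfc f x * s = -cfc f x := by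
    have e : s * cfc f x * s = s * cfc f x * star s := by rw [hss.star_eq]
    rw [e]
    refine h.trans ?_
    refine (congrArg (cfc f) hu).trans ?_
    rw [← cfc_comp_neg .., ← cfc_neg]
    simp [hodd]
  calc s * cfc f x = s * cfc f x * s * s := by rw [mul_assoc _ s s, hs, mul_one]
    _ = _ := by rw [h', neg_mul]

end CStarAlgebra

section VonNeumann

variable {H : Type*} [NormedAddCommGroup H] [InnerProductSpace ℂ H] [CompleteSpace H]

theorem VonNeumannAlgebra.mem_of_commute {A : VonNeumannAlgebra H} {x : H →L[ℂ] H}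
    (h : ∀ y ∈ A.commutant, Commute y x) : x ∈ A := by
  rw [← A.commutant_commutant, VonNeumannAlgebra.mem_commutant_iff]
  exact fun y hy => h y hy

theorem VonNeumannAlgebra.commute_of_mem {A : VonNeumannAlgebra H} {x y : H →L[ℂ] H}
    (hy : y ∈ A.commutant) (hx : x ∈ A) : Commute y x :=
  (VonNeumannAlgebra.mem_commutant_iff.1 hy x hx).symm

theorem VonNeumannAlgebra.real_smul_mem {A : VonNeumannAlgebra H} {x : H →L[ℂ] H} (r : ℝ)
    (hx : x ∈ A) : r • x ∈ A :=
  VonNeumannAlgebra.mem_of_commute fun _ hy => (commute_of_mem hy hx).smul_right r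

theorem VonNeumannAlgebra.exp_mem {A : VonNeumannAlgebra H} {x : H →L[ℂ] H} (hx : x ∈ A) :
    NormedSpace.exp x ∈ A :=
  VonNeumannAlgebra.mem_of_commute fun _ hy => (commute_of_mem hy hx).exp_right

theorem VonNeumannAlgebra.cfc_mem {A : VonNeumannAlgebra H} {x : H →L[ℂ] H}
    (hsa : IsSelfAdjoint x) (hx : x ∈ A) (f : ℝ → ℝ) : cfc f x ∈ A :=
  VonNeumannAlgebra.mem_of_commute fun _ hy =>
    (hsa.commute_cfc (commute_of_mem hy hx).symm f).symm

/-- The orthogonal projection onto the closure of the range of `x`. -/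
noncomputable def rangeProj (x : H →L[ℂ] H) : H →L[ℂ] H :=
  x.range.topologicalClosure.starProjection

theorem isStarProjection_rangeProj (x : H →L[ℂ] H) : IsStarProjection (rangeProj x) :=
  isStarProjection_starProjection

theorem rangeProj_mul_self (x : H →L[ℂ] H) : rangeProj x * x = x := by
  ext ξ
  exact Submodule.starProjection_eq_self_iff.2
    (Submodule.le_topologicalClosure _ (LinearMap.mem_range_self _ ξ))

theorem mul_rangeProj_eq_zero {x y : H →L[ℂ] H} (h : y * x = 0) : y * rangeProj x = 0 := by
  ext ξ
  have hle : x.range.topologicalClosure ≤ y.ker := by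
    refine Submodule.topologicalClosure_minimal _ ?_ y.isClosed_ker
    rintro _ ⟨ζ, rfl⟩
    exact congrArg (fun w : H →L[ℂ] H => w ζ) h
  exact hle (Submodule.starProjection_apply_mem _ ξ)

theorem rangeProj_mul_eq_zero {x y : H →L[ℂ] H} (hx : IsSelfAdjoint x) (h : x * y = 0) :
    rangeProj x * y = 0 := by
  have h1 : star y * x = 0 := by
    simpa [hx.star_eq] using congrArg star h
  simpa [(isStarProjection_rangeProj x).isSelfAdjoint.star_eq] using
    congrArg star (mul_rangeProj_eq_zero h1)

theorem rangeProj_mem {A : VonNeumannAlgebra H} {x : H →L[ℂ] H} (hx : x ∈ A) :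
    rangeProj x ∈ A := by
  refine (VonNeumannAlgebra.IsStarProjection.mem_iff (isStarProjection_rangeProj x) A).2
    fun y hy => ?_
  have hc := VonNeumannAlgebra.commute_of_mem hy hx
  rw [rangeProj, Submodule.range_starProjection]
  intro ξ hξ
  have hmaps : Set.MapsTo y x.range x.range := by
    rintro _ ⟨ζ, rfl⟩
    exact ⟨y ζ, (congrArg (fun w : H →L[ℂ] H => w ζ) hc).symm⟩
  exact hmaps.closure y.continuous hξ

theorem isStarProjection_projInf (p q : H →L[ℂ] H) : IsStarProjection (projInf p q) :=
  isStarProjection_starProjection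

theorem mul_projInf_left {p q : H →L[ℂ] H} (hp : IsStarProjection p) (hq : IsStarProjection q) :
    p * projInf p q = projInf p q := by
  ext ξ
  have h : projInf p q ξ ∈ (projInf p q).range := ⟨ξ, rfl⟩
  rw [range_projInf hp hq] at h
  obtain ⟨ζ, hζ⟩ := h.1
  change p (projInf p q ξ) = _
  rw [← hζ]
  exact congrArg (fun w : H →L[ℂ] H => w ζ) hp.isIdempotentElem

theorem mul_projInf_right {p q : H →L[ℂ] H} (hp : IsStarProjection p) (hq : IsStarProjection q) :
    q * projInf p q = projInf p q := by
  ext ξ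
  have h : projInf p q ξ ∈ (projInf p q).range := ⟨ξ, rfl⟩
  rw [range_projInf hp hq] at h
  obtain ⟨ζ, hζ⟩ := h.2
  change q (projInf p q ξ) = _
  rw [← hζ]
  exact congrArg (fun w : H →L[ℂ] H => w ζ) hq.isIdempotentElem

theorem projInf_mul_eq_self {p q x : H →L[ℂ] H} (h1 : p * x = x) (h2 : q * x = x) :
    projInf p q * x = x := by
  ext ξ
  refine Submodule.starProjection_eq_self_iff.2 (Submodule.le_topologicalClosure _ ⟨⟨x ξ, ?_⟩,
    ⟨x ξ, ?_⟩⟩)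
  · exact congrArg (fun w : H →L[ℂ] H => w ξ) h1
  · exact congrArg (fun w : H →L[ℂ] H => w ξ) h2

theorem projInf_mem {A : VonNeumannAlgebra H} {p q : H →L[ℂ] H} (hp : p ∈ projectionSet A)
    (hq : q ∈ projectionSet A) : projInf p q ∈ A := by
  refine VonNeumannAlgebra.mem_of_commute fun y hy => ?_
  have aux : ∀ y ∈ A.commutant, projInf p q * (y * projInf p q) = y * projInf p q := by
    intro y hy
    refine projInf_mul_eq_self ?_ ?_
    · rw [← mul_assoc, ← (VonNeumannAlgebra.commute_of_mem hy hp.1).eq, mul_assoc,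
        mul_projInf_left hp.2 hq.2]
    · rw [← mul_assoc, ← (VonNeumannAlgebra.commute_of_mem hy hq.1).eq, mul_assoc,
        mul_projInf_right hp.2 hq.2]
  have h1 := aux y hy
  have h2 := congrArg star (aux _ (star_mem hy))
  simp only [star_mul, star_star, (isStarProjection_projInf p q).isSelfAdjoint.star_eq] at h2
  rw [Commute, SemiconjBy, ← h1, ← mul_assoc, h2]

theorem one_sub_mem_projectionSet {A : VonNeumannAlgebra H} {p : H →L[ℂ] H}
    (hp : p ∈ projectionSet A) : 1 - p ∈ projectionSet A :=
  ⟨sub_mem (one_mem A) hp.1, hp.2.one_sub⟩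

end VonNeumann

section TwoProjections

variable {H : Type*} [NormedAddCommGroup H] [InnerProductSpace ℂ H] [CompleteSpace H]
  {p q v : H →L[ℂ] H}

theorem abs_le_norm_of_mem_spectrum {x : H →L[ℂ] H} {t : ℝ} (ht : t ∈ spectrum ℝ x) :
    |t| ≤ ‖x‖ := by
  have h2 : ‖t‖ ≤ ‖x‖ * ‖(1 : H →L[ℂ] H)‖ := spectrum.norm_le_norm_mul_of_mem ht
  have h3 : ‖(1 : H →L[ℂ] H)‖ ≤ 1 := ContinuousLinearMap.norm_id_le
  rw [← Real.norm_eq_abs]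
  nlinarith [norm_nonneg x]

theorem symmetry_mul_self (hp : IsStarProjection p) : (2 * p - 1) * (2 * p - 1) = 1 := by
  have hpp : p * p = p := hp.isIdempotentElem
  simp only [mul_sub, sub_mul, two_mul, mul_add, add_mul, mul_one, one_mul, hpp]
  abel

theorem symmetry_mem_unitary (hp : IsStarProjection p) : 2 * p - 1 ∈ unitary (H →L[ℂ] H) := by
  have hsa : star (2 * p - 1) = 2 * p - 1 := by
    simp [hp.isSelfAdjoint.star_eq, two_mul]
  simp only [Unitary.mem_iff, hsa, symmetry_mul_self hp, and_self]

theorem sub_mul_add_sub_one (hp : IsStarProjection p) (hq : IsStarProjection q) :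
    (p - q) * (p + q - 1) = -((p + q - 1) * (p - q)) := by
  have h1 : p * p = p := hp.isIdempotentElem
  have h2 : q * q = q := hq.isIdempotentElem
  simp only [mul_sub, sub_mul, mul_add, add_mul, h1, h2, mul_one, one_mul]
  abel

theorem sub_sq_add_add_sub_one_sq (hp : IsStarProjection p) (hq : IsStarProjection q) :
    (p - q) * (p - q) + (p + q - 1) * (p + q - 1) = 1 := by
  have h1 : p * p = p := hp.isIdempotentElem
  have h2 : q * q = q := hq.isIdempotentElem
  simp only [mul_sub, sub_mul, mul_add, add_mul, h1, h2, mul_one, one_mul]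
  abel

theorem abs_le_one_of_mem_spectrum_sub (hp : IsStarProjection p) (hq : IsStarProjection q) {t : ℝ}
    (ht : t ∈ spectrum ℝ (p - q)) : |t| ≤ 1 := by
  have hsa : IsSelfAdjoint (p - q) := hp.isSelfAdjoint.sub hq.isSelfAdjoint
  have hsb : IsSelfAdjoint (p + q - 1) :=
    (hp.isSelfAdjoint.add hq.isSelfAdjoint).sub (.one _)
  have hle : (p - q) * (p - q) ≤ 1 := by
    rw [← sub_sq_add_add_sub_one_sq hp hq]
    exact le_add_of_nonneg_right hsb.mul_self_nonneg
  have hn : ‖(p - q) * (p - q)‖ ≤ 1 :=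
    (CStarAlgebra.norm_le_one_iff_of_nonneg _ hsa.mul_self_nonneg).2 hle
  rw [hsa.norm_mul_self] at hn
  have h1 : ‖p - q‖ ≤ 1 := by nlinarith [norm_nonneg (p - q)]
  exact (abs_le_norm_of_mem_spectrum ht).trans h1

/-- The cosine of the operator angle between two projections. -/
noncomputable def cosAngle (p q : H →L[ℂ] H) : H →L[ℂ] H :=
  cfc (fun t : ℝ => √(1 - t ^ 2)) (p - q)

theorem isSelfAdjoint_cosAngle : IsSelfAdjoint (cosAngle p q) := cfc_predicate _ _

theorem cosAngle_mul_self (hp : IsStarProjection p) (hq : IsStarProjection q) :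
    cosAngle p q * cosAngle p q = (p + q - 1) * (p + q - 1) := by
  have hsa : IsSelfAdjoint (p - q) := hp.isSelfAdjoint.sub hq.isSelfAdjoint
  rw [eq_sub_iff_add_eq'.2 (sub_sq_add_add_sub_one_sq hp hq), cosAngle, ← cfc_mul ..]
  have : cfc (fun t : ℝ => √(1 - t ^ 2) * √(1 - t ^ 2)) (p - q) =
      cfc (fun t : ℝ => 1 - t ^ 2) (p - q) := by
    refine cfc_congr fun t ht => Real.mul_self_sqrt ?_
    have := abs_le_one_of_mem_spectrum_sub hp hq ht
    nlinarith [abs_nonneg t, sq_abs t]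
  rw [this, cfc_sub .., cfc_const_one .., cfc_pow_id .., pow_two]

theorem commute_cosAngle_sub (hp : IsStarProjection p) (hq : IsStarProjection q) :
    Commute (cosAngle p q) (p - q) :=
  (hp.isSelfAdjoint.sub hq.isSelfAdjoint).commute_cfc (Commute.refl _) _

theorem commute_cosAngle_add (hp : IsStarProjection p) (hq : IsStarProjection q) :
    Commute (cosAngle p q) (p + q - 1) := by
  have hsa : IsSelfAdjoint (p - q) := hp.isSelfAdjoint.sub hq.isSelfAdjoint
  have : cosAngle p q = cfc (fun s : ℝ => √(1 - s)) ((p - q) ^ 2) := by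
    rw [cosAngle, ← cfc_comp_pow (fun s : ℝ => √(1 - s)) 2 (p - q)]
  rw [this]
  refine (hsa.pow 2).commute_cfc ?_ _
  have h := sub_mul_add_sub_one hp hq
  rw [Commute, SemiconjBy, pow_two, mul_assoc, h, mul_neg, ← mul_assoc, h, neg_mul, neg_neg,
    mul_assoc]

/-- The partial symmetry onto the orthocomplement of the kernel of `p + q - 1`: the sign of
`p + q - 1`. -/
noncomputable def signAdd (p q : H →L[ℂ] H) : H →L[ℂ] H :=
  rangeProj (cosAngle p q + (p + q - 1)) - rangeProj (cosAngle p q - (p + q - 1))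

end TwoProjections

section SignAlgebra

variable {H : Type*} [NormedAddCommGroup H] [InnerProductSpace ℂ H] [CompleteSpace H]
  {a b m : H →L[ℂ] H}

theorem rangeProj_add_mul_rangeProj_sub (hm : IsSelfAdjoint m) (hb : IsSelfAdjoint b)
    (hsq : m * m = b * b) (hc : Commute m b) :
    rangeProj (m + b) * rangeProj (m - b) = 0 := by
  refine mul_rangeProj_eq_zero (rangeProj_mul_eq_zero (hm.add hb) ?_)
  rw [mul_sub, add_mul, add_mul, hsq, hc.eq]
  abel

theorem rangeProj_sub_mul_rangeProj_add (hm : IsSelfAdjoint m) (hb : IsSelfAdjoint b)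
    (hsq : m * m = b * b) (hc : Commute m b) :
    rangeProj (m - b) * rangeProj (m + b) = 0 := by
  simpa [(isStarProjection_rangeProj _).isSelfAdjoint.star_eq] using
    congrArg star (rangeProj_add_mul_rangeProj_sub hm hb hsq hc)

theorem signProj_mul (hm : IsSelfAdjoint m) (hb : IsSelfAdjoint b)
    (hsq : m * m = b * b) (hc : Commute m b) :
    (rangeProj (m + b) - rangeProj (m - b)) * b = m := by
  have h1 := rangeProj_mul_self (m + b)
  have h2 := rangeProj_mul_self (m - b)
  have h3 : rangeProj (m + b) * (m - b) = 0 := rangeProj_mul_eq_zero (hm.add hb) (by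
    rw [mul_sub, add_mul, add_mul, hsq, hc.eq]; abel)
  have h4 : rangeProj (m - b) * (m + b) = 0 := rangeProj_mul_eq_zero (hm.sub hb) (by
    rw [mul_add, sub_mul, sub_mul, hsq, hc.eq]; abel)
  refine smul_right_injective _ (two_ne_zero' ℂ) ?_
  simp only [mul_add, mul_sub, sub_mul] at *
  linear_combination (norm := module) h1 - h3 + h2 - h4

theorem signProj_mul_signProj (hm : IsSelfAdjoint m) (hb : IsSelfAdjoint b)
    (hsq : m * m = b * b) (hc : Commute m b) :
    (rangeProj (m + b) - rangeProj (m - b)) * (rangeProj (m + b) - rangeProj (m - b)) =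
      rangeProj (m + b) + rangeProj (m - b) := by
  have h1 : rangeProj (m + b) * rangeProj (m + b) = _ :=
    (isStarProjection_rangeProj (m + b)).isIdempotentElem
  have h2 : rangeProj (m - b) * rangeProj (m - b) = _ :=
    (isStarProjection_rangeProj (m - b)).isIdempotentElem
  rw [mul_sub, sub_mul, sub_mul, h1, h2, rangeProj_add_mul_rangeProj_sub hm hb hsq hc,
    rangeProj_sub_mul_rangeProj_add hm hb hsq hc]
  abel

theorem mul_rangeProj_of_mul_eq {a x y : H →L[ℂ] H} (ha : IsSelfAdjoint a)
    (hxy : a * x = y * a) (hyx : a * y = x * a) : a * rangeProj x = rangeProj y * a := by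
  have key : ∀ {x y : H →L[ℂ] H}, a * x = y * a → rangeProj y * a * rangeProj x = a * rangeProj x := by
    intro x y h
    have : (rangeProj y * a - a) * rangeProj x = 0 := by
      refine mul_rangeProj_eq_zero ?_
      rw [sub_mul, mul_assoc, h, ← mul_assoc, rangeProj_mul_self, sub_self]
    rwa [sub_mul, sub_eq_zero] at this
  have h2 := congrArg star (key hyx)
  simp only [star_mul, ha.star_eq, (isStarProjection_rangeProj _).isSelfAdjoint.star_eq] at h2
  rw [← key hxy, mul_assoc, h2]

theorem mul_signProj (ha : IsSelfAdjoint a) (hab : a * b = -(b * a)) (ham : Commute m a) :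
    a * (rangeProj (m + b) - rangeProj (m - b)) =
      -((rangeProj (m + b) - rangeProj (m - b)) * a) := by
  have h1 : a * (m + b) = (m - b) * a := by rw [mul_add, hab, sub_mul, ham.eq, sub_eq_add_neg]
  have h2 : a * (m - b) = (m + b) * a := by rw [mul_sub, hab, add_mul, ham.eq, sub_neg_eq_add]
  rw [mul_sub, mul_rangeProj_of_mul_eq ha h1 h2, mul_rangeProj_of_mul_eq ha h2 h1, sub_mul, neg_sub]

theorem rangeProj_add_rangeProj_mul (hm : IsSelfAdjoint m) (hb : IsSelfAdjoint b)
    (hsq : m * m = b * b) (hc : Commute m b) :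
    (rangeProj (m + b) + rangeProj (m - b)) * b = b := by
  have h1 := rangeProj_mul_self (m + b)
  have h2 := rangeProj_mul_self (m - b)
  have h3 : rangeProj (m + b) * (m - b) = 0 := rangeProj_mul_eq_zero (hm.add hb) (by
    rw [mul_sub, add_mul, add_mul, hsq, hc.eq]; abel)
  have h4 : rangeProj (m - b) * (m + b) = 0 := rangeProj_mul_eq_zero (hm.sub hb) (by
    rw [mul_add, sub_mul, sub_mul, hsq, hc.eq]; abel)
  refine smul_right_injective _ (two_ne_zero' ℂ) ?_
  simp only [mul_add, mul_sub, add_mul] at *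
  linear_combination (norm := module) h1 - h3 - h2 + h4

theorem rangeProj_add_rangeProj_mul_eq_zero {x : H →L[ℂ] H} (hm : IsSelfAdjoint m)
    (hb : IsSelfAdjoint b) (hsq : m * m = b * b) (hc : Commute m b) (hx : b * x = 0) :
    rangeProj (m + b) * x = 0 ∧ rangeProj (m - b) * x = 0 := by
  have hmx : m * x = 0 := by rw [← signProj_mul hm hb hsq hc, mul_assoc, hx, mul_zero]
  exact ⟨rangeProj_mul_eq_zero (hm.add hb) (by rw [add_mul, hmx, hx, add_zero]),
    rangeProj_mul_eq_zero (hm.sub hb) (by rw [sub_mul, hmx, hx, sub_zero])⟩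

end SignAlgebra

section Symmetry

variable {H : Type*} [NormedAddCommGroup H] [InnerProductSpace ℂ H] [CompleteSpace H]
  {p q v : H →L[ℂ] H}

theorem mul_star_mul_self_of_isStarProjection (hv : IsStarProjection (star v * v)) :
    v * (star v * v) = v := by
  have hidem : star v * v * (star v * v) = star v * v := hv.isIdempotentElem
  rw [← sub_eq_zero, ← CStarRing.star_mul_self_eq_zero_iff]
  simp only [star_sub, star_mul, star_star, sub_mul, mul_sub]
  simp only [← mul_assoc] at *
  simp [hidem]

theorem mul_projInf_compl_right (hp : IsStarProjection p) (hq : IsStarProjection q) :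
    p * projInf p (1 - q) = projInf p (1 - q) ∧ q * projInf p (1 - q) = 0 := by
  refine ⟨mul_projInf_left hp hq.one_sub, ?_⟩
  have h := mul_projInf_right hp hq.one_sub
  rwa [sub_mul, one_mul, sub_eq_self] at h

theorem mul_projInf_compl_left (hp : IsStarProjection p) (hq : IsStarProjection q) :
    p * projInf (1 - p) q = 0 ∧ q * projInf (1 - p) q = projInf (1 - p) q := by
  refine ⟨?_, mul_projInf_right hp.one_sub hq⟩
  have h := mul_projInf_left hp.one_sub hq
  rwa [sub_mul, one_mul, sub_eq_self] at h

theorem isSelfAdjoint_add_sub_one (hp : IsStarProjection p) (hq : IsStarProjection q) :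
    IsSelfAdjoint (p + q - 1) :=
  (hp.isSelfAdjoint.add hq.isSelfAdjoint).sub (.one _)

/-- The kernel of `p + q - 1` is the sum of the ranges of `p ∧ q^⊥` and `p^⊥ ∧ q`. -/
theorem projInf_add_projInf_mul (hp : IsStarProjection p) (hq : IsStarProjection q)
    {x : H →L[ℂ] H} (hx : (p + q - 1) * x = 0) :
    (projInf p (1 - q) + projInf (1 - p) q) * x = x := by
  have hpp : p * p = p := hp.isIdempotentElem
  have hqq : q * q = q := hq.isIdempotentElem
  have hx' : p * x + q * x = x := by
    rwa [sub_mul, add_mul, one_mul, sub_eq_zero] at hx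
  have hqp : q * (p * x) = 0 := by
    have := congrArg (q * ·) hx'
    simpa [mul_add, ← mul_assoc, hqq] using this
  have h1 : projInf p (1 - q) * (p * x) = p * x :=
    projInf_mul_eq_self (by rw [← mul_assoc, hpp]) (by rw [sub_mul, one_mul, hqp, sub_zero])
  have hpq : p * (q * x) = 0 := by
    have := congrArg (p * ·) hx'
    simpa [mul_add, ← mul_assoc, hpp] using this
  have h2 : projInf (1 - p) q * (q * x) = q * x :=
    projInf_mul_eq_self (by rw [sub_mul, one_mul, hpq, sub_zero]) (by rw [← mul_assoc, hqq])
  have h3 : projInf p (1 - q) * q = 0 := by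
    have := congrArg star (mul_projInf_compl_right hp hq).2
    simpa [hq.isSelfAdjoint.star_eq, (isStarProjection_projInf _ _).isSelfAdjoint.star_eq] using this
  have h4 : projInf (1 - p) q * p = 0 := by
    have := congrArg star (mul_projInf_compl_left hp hq).1
    simpa [hp.isSelfAdjoint.star_eq, (isStarProjection_projInf _ _).isSelfAdjoint.star_eq] using this
  calc (projInf p (1 - q) + projInf (1 - p) q) * x
      = (projInf p (1 - q) + projInf (1 - p) q) * (p * x + q * x) := by rw [hx']
    _ = p * x + q * x := by
      rw [add_mul, mul_add, mul_add, h1, h2, ← mul_assoc, ← mul_assoc, h3, h4]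
      simp
    _ = x := hx'

theorem add_sub_one_mul_projInf_add (hp : IsStarProjection p) (hq : IsStarProjection q) :
    (p + q - 1) * (projInf p (1 - q) + projInf (1 - p) q) = 0 := by
  obtain ⟨h1, h2⟩ := mul_projInf_compl_right hp hq
  obtain ⟨h3, h4⟩ := mul_projInf_compl_left hp hq
  simp only [sub_mul, add_mul, mul_add, h1, h2, h3, h4, one_mul]
  abel

theorem rangeProj_add_projInf_eq_one (hp : IsStarProjection p) (hq : IsStarProjection q) :
    rangeProj (cosAngle p q + (p + q - 1)) + rangeProj (cosAngle p q - (p + q - 1)) +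
      (projInf p (1 - q) + projInf (1 - p) q) = 1 := by
  have hb := isSelfAdjoint_add_sub_one hp hq
  have hm : IsSelfAdjoint (cosAngle p q) := isSelfAdjoint_cosAngle
  have hsq := cosAngle_mul_self hp hq
  have hc := commute_cosAngle_add hp hq
  have hP := (isStarProjection_rangeProj (cosAngle p q + (p + q - 1))).isSelfAdjoint
  have hQ := (isStarProjection_rangeProj (cosAngle p q - (p + q - 1))).isSelfAdjoint
  have hE := (isStarProjection_projInf p (1 - q)).isSelfAdjoint.add
    (isStarProjection_projInf (1 - p) q).isSelfAdjoint
  have h0 := add_sub_one_mul_projInf_add hp hq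
  obtain ⟨h1, h2⟩ := rangeProj_add_rangeProj_mul_eq_zero hm hb hsq hc h0
  have h3 := rangeProj_add_rangeProj_mul hm hb hsq hc
  have h4 := congrArg star h3
  rw [star_mul, hb.star_eq, (hP.add hQ).star_eq] at h4
  have h5 := projInf_add_projInf_mul hp hq
    (x := 1 - (rangeProj (cosAngle p q + (p + q - 1)) + rangeProj (cosAngle p q - (p + q - 1))))
    (by rw [mul_sub, mul_one, h4, sub_self])
  have h6 := congrArg star h5
  rw [star_mul, hE.star_eq, star_sub, star_one, (hP.add hQ).star_eq, sub_mul, one_mul, add_mul, h1,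
    h2, add_zero, sub_zero] at h6
  rw [h6]
  abel

/-- The symmetry exchanging `p` and `q` which extends `signAdd p q` by means of a partial isometry
`v` between `p ∧ q^⊥` and `p^⊥ ∧ q`. -/
noncomputable def exchange (p q v : H →L[ℂ] H) : H →L[ℂ] H :=
  signAdd p q + (v + star v)

theorem isSelfAdjoint_exchange : IsSelfAdjoint (exchange p q v) :=
  ((isStarProjection_rangeProj _).isSelfAdjoint.sub (isStarProjection_rangeProj _).isSelfAdjoint).add
    (.add_star_self v)

/-- The identities satisfied by a partial isometry from `p ∧ q^⊥` to `p^⊥ ∧ q`. -/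
theorem projections_mul_partialIsometry (hp : IsStarProjection p) (hq : IsStarProjection q)
    (h1 : star v * v = projInf p (1 - q)) (h2 : v * star v = projInf (1 - p) q) :
    p * v = 0 ∧ q * v = v ∧ v * p = v ∧ v * q = 0 := by
  have hve : v * projInf p (1 - q) = v := by
    rw [← h1]
    exact mul_star_mul_self_of_isStarProjection (h1 ▸ isStarProjection_projInf _ _)
  have hfv : projInf (1 - p) q * v = v := by
    rw [← h2, mul_assoc, h1, hve]
  obtain ⟨e1, e2⟩ := mul_projInf_compl_right hp hq
  obtain ⟨f1, f2⟩ := mul_projInf_compl_left hp hq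
  have e1' := congrArg star e1
  have e2' := congrArg star e2
  simp only [star_mul, star_zero, hp.isSelfAdjoint.star_eq, hq.isSelfAdjoint.star_eq,
    (isStarProjection_projInf _ _).isSelfAdjoint.star_eq] at e1' e2'
  refine ⟨?_, ?_, ?_, ?_⟩
  · rw [← hfv, ← mul_assoc, f1, zero_mul]
  · rw [← hfv, ← mul_assoc, f2]
  · rw [← hve, mul_assoc, e1']
  · rw [← hve, mul_assoc, e2', mul_zero]

theorem partialIsometry_mul_self (hp : IsStarProjection p) (hq : IsStarProjection q)
    (h1 : star v * v = projInf p (1 - q)) (h2 : v * star v = projInf (1 - p) q) : v * v = 0 := by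
  obtain ⟨hpv, -, hvp, -⟩ := projections_mul_partialIsometry hp hq h1 h2
  rw [← hvp, mul_assoc, ← mul_assoc p, hpv]
  simp

theorem exchange_mul_sub (hp : IsStarProjection p) (hq : IsStarProjection q)
    (h1 : star v * v = projInf p (1 - q)) (h2 : v * star v = projInf (1 - p) q) :
    exchange p q v * (p - q) = -((p - q) * exchange p q v) := by
  obtain ⟨hpv, hqv, hvp, hvq⟩ := projections_mul_partialIsometry hp hq h1 h2
  have hs := mul_signProj (hp.isSelfAdjoint.sub hq.isSelfAdjoint) (sub_mul_add_sub_one hp hq)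
    (commute_cosAngle_sub hp hq)
  have hpv' := congrArg star hpv
  have hqv' := congrArg star hqv
  have hvp' := congrArg star hvp
  have hvq' := congrArg star hvq
  simp only [star_mul, star_zero, hp.isSelfAdjoint.star_eq, hq.isSelfAdjoint.star_eq]
    at hpv' hqv' hvp' hvq'
  rw [exchange, mul_add, signAdd, hs, add_mul]
  simp only [mul_add, add_mul, mul_sub, sub_mul, hpv, hqv, hvp, hvq, hpv', hqv', hvp', hvq']
  abel

theorem exchange_mul_add_sub_one (hp : IsStarProjection p) (hq : IsStarProjection q)
    (h1 : star v * v = projInf p (1 - q)) (h2 : v * star v = projInf (1 - p) q) :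
    exchange p q v * (p + q - 1) = cosAngle p q := by
  obtain ⟨hpv, hqv, hvp, hvq⟩ := projections_mul_partialIsometry hp hq h1 h2
  have hs := signProj_mul isSelfAdjoint_cosAngle (isSelfAdjoint_add_sub_one hp hq)
    (cosAngle_mul_self hp hq) (commute_cosAngle_add hp hq)
  have hpv' := congrArg star hpv
  have hqv' := congrArg star hqv
  simp only [star_mul, star_zero, hp.isSelfAdjoint.star_eq, hq.isSelfAdjoint.star_eq] at hpv' hqv'
  have hv : (v + star v) * (p + q - 1) = 0 := by
    simp only [mul_add, add_mul, mul_sub, hvp, hvq, hpv', hqv', mul_one]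
    abel
  rw [exchange, add_mul, signAdd, hs, hv, add_zero]

theorem exchange_mul_self (hp : IsStarProjection p) (hq : IsStarProjection q)
    (h1 : star v * v = projInf p (1 - q)) (h2 : v * star v = projInf (1 - p) q) :
    exchange p q v * exchange p q v = 1 := by
  obtain ⟨hpv, hqv, hvp, hvq⟩ := projections_mul_partialIsometry hp hq h1 h2
  have hm : IsSelfAdjoint (cosAngle p q) := isSelfAdjoint_cosAngle
  have hb := isSelfAdjoint_add_sub_one hp hq
  have hsq := cosAngle_mul_self hp hq
  have hc := commute_cosAngle_add hp hq
  have hvp' := congrArg star hvp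
  have hvq' := congrArg star hvq
  simp only [star_mul, star_zero, hp.isSelfAdjoint.star_eq, hq.isSelfAdjoint.star_eq] at hvp' hvq'
  have hvv := partialIsometry_mul_self hp hq h1 h2
  have hvv' : star v * star v = 0 := by simpa using congrArg star hvv
  have hbv : (p + q - 1) * (v + star v) = 0 := by
    simp only [mul_add, add_mul, sub_mul, hpv, hqv, hvp', hvq', one_mul]
    abel
  obtain ⟨hP, hQ⟩ := rangeProj_add_rangeProj_mul_eq_zero hm hb hsq hc hbv
  have hs : signAdd p q * (v + star v) = 0 := by rw [signAdd, sub_mul, hP, hQ, sub_zero]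
  have hs' : (v + star v) * signAdd p q = 0 := by
    have hss : IsSelfAdjoint (signAdd p q) :=
      (isStarProjection_rangeProj _).isSelfAdjoint.sub (isStarProjection_rangeProj _).isSelfAdjoint
    have := congrArg star hs
    rwa [star_mul, hss.star_eq, (IsSelfAdjoint.add_star_self v).star_eq, star_zero] at this
  have hv : (v + star v) * (v + star v) = projInf p (1 - q) + projInf (1 - p) q := by
    rw [add_mul, mul_add, mul_add, hvv, hvv', h1, h2]
    abel
  rw [exchange, add_mul, mul_add (signAdd p q), mul_add (v + star v), hs, hs', hv, signAdd, signProj_mul_signProj hm hb hsq hc,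
    add_zero, zero_add, rangeProj_add_projInf_eq_one hp hq]

theorem exchange_mem {A : VonNeumannAlgebra H} (hp : p ∈ projectionSet A)
    (hq : q ∈ projectionSet A) (hv : v ∈ A) : exchange p q v ∈ A := by
  have hb : p + q - 1 ∈ A := sub_mem (add_mem hp.1 hq.1) (one_mem A)
  have hm : cosAngle p q ∈ A := VonNeumannAlgebra.cfc_mem
    (hp.2.isSelfAdjoint.sub hq.2.isSelfAdjoint) (sub_mem hp.1 hq.1) _
  exact add_mem (sub_mem (rangeProj_mem (add_mem hm hb)) (rangeProj_mem (sub_mem hm hb)))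
    (add_mem hv (star_mem hv))

/-- The operator angle between two projections, with the sign of `p - q`. -/
noncomputable def angle (p q : H →L[ℂ] H) : H →L[ℂ] H := cfc Real.arcsin (p - q)

theorem isSelfAdjoint_angle : IsSelfAdjoint (angle p q) := cfc_predicate _ _

theorem norm_angle_le_arcsin_norm : ‖angle p q‖ ≤ Real.arcsin ‖p - q‖ := by
  refine norm_cfc_le (Real.arcsin_nonneg.2 (norm_nonneg _)) fun t ht => ?_
  have h4 := abs_le_norm_of_mem_spectrum ht
  rw [Real.norm_eq_abs, abs_le, ← Real.arcsin_neg]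
  exact ⟨Real.monotone_arcsin (abs_le.1 h4).1, Real.monotone_arcsin (abs_le.1 h4).2⟩

theorem norm_angle_le : ‖angle p q‖ ≤ Real.pi / 2 :=
  norm_angle_le_arcsin_norm.trans (Real.arcsin_le_pi_div_two _)

/-- The initial velocity, as an element of the Lie algebra, of a geodesic from `p` to `q`. -/
noncomputable def direction (p q v : H →L[ℂ] H) : H →L[ℂ] H := exchange p q v * angle p q

theorem exchange_mul_angle (hp : IsStarProjection p) (hq : IsStarProjection q)
    (h1 : star v * v = projInf p (1 - q)) (h2 : v * star v = projInf (1 - p) q) :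
    exchange p q v * angle p q = -(angle p q * exchange p q v) :=
  mul_cfc_of_anticommute (hp.isSelfAdjoint.sub hq.isSelfAdjoint) isSelfAdjoint_exchange
    (exchange_mul_self hp hq h1 h2) (exchange_mul_sub hp hq h1 h2) Real.continuous_arcsin
    Real.arcsin_neg

theorem star_direction (hp : IsStarProjection p) (hq : IsStarProjection q)
    (h1 : star v * v = projInf p (1 - q)) (h2 : v * star v = projInf (1 - p) q) :
    star (direction p q v) = -direction p q v := by
  rw [direction, star_mul, isSelfAdjoint_angle.star_eq, isSelfAdjoint_exchange.star_eq,
    exchange_mul_angle hp hq h1 h2, neg_neg]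

theorem exp_direction (hp : IsStarProjection p) (hq : IsStarProjection q)
    (h1 : star v * v = projInf p (1 - q)) (h2 : v * star v = projInf (1 - p) q) :
    NormedSpace.exp (direction p q v) = exchange p q v * (2 * p - 1) := by
  have hsa : IsSelfAdjoint (p - q) := hp.isSelfAdjoint.sub hq.isSelfAdjoint
  have hsin : cfc Real.sin (angle p q) = p - q := by
    rw [angle, ← cfc_comp' Real.sin Real.arcsin (p - q)
      (hg := Real.continuous_sin.continuousOn) (hf := Real.continuous_arcsin.continuousOn)]
    conv_rhs => rw [← cfc_id' ℝ (p - q)]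
    refine cfc_congr fun t ht => ?_
    have := abs_le.1 (abs_le_one_of_mem_spectrum_sub hp hq ht)
    exact Real.sin_arcsin this.1 this.2
  have hcos : cfc Real.cos (angle p q) = cosAngle p q := by
    rw [angle, ← cfc_comp' Real.cos Real.arcsin (p - q)
      (hg := Real.continuous_cos.continuousOn) (hf := Real.continuous_arcsin.continuousOn)]
    simp only [Real.cos_arcsin, cosAngle]
  rw [direction, exp_mul_eq_cos_add_mul_sin isSelfAdjoint_angle (exchange_mul_self hp hq h1 h2)
    (exchange_mul_angle hp hq h1 h2), hsin, hcos, show 2 * p - 1 = (p - q) + (p + q - 1) by rw [two_mul]; abel, mul_add,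
    exchange_mul_add_sub_one hp hq h1 h2, add_comm]

theorem direction_mul_add_mul_direction (hp : IsStarProjection p) (hq : IsStarProjection q)
    (h1 : star v * v = projInf p (1 - q)) (h2 : v * star v = projInf (1 - p) q) :
    direction p q v * p + p * direction p q v = direction p q v := by
  have hsa : IsSelfAdjoint (p - q) := hp.isSelfAdjoint.sub hq.isSelfAdjoint
  have hSS := exchange_mul_self hp hq h1 h2
  have hSθ := exchange_mul_angle hp hq h1 h2
  have hSb := exchange_mul_add_sub_one hp hq h1 h2
  have hSa := exchange_mul_sub hp hq h1 h2
  have hb : p + q - 1 = exchange p q v * cosAngle p q := by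
    rw [← hSb, ← mul_assoc, hSS, one_mul]
  have hθa : Commute (angle p q) (p - q) := hsa.commute_cfc (Commute.refl _) _
  have hθm : Commute (angle p q) (cosAngle p q) := cfc_commute_cfc _ _ _
  have hbS : (p + q - 1) * exchange p q v = cosAngle p q := by
    have := congrArg star hSb
    rwa [star_mul, isSelfAdjoint_exchange.star_eq, isSelfAdjoint_cosAngle.star_eq,
      (isSelfAdjoint_add_sub_one hp hq).star_eq] at this
  have e1 : direction p q v * (p - q) + (p - q) * direction p q v = 0 := by
    rw [direction, mul_assoc, hθa.eq, ← mul_assoc, ← mul_assoc, hSa]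
    noncomm_ring
  have e2 : direction p q v * (p + q - 1) + (p + q - 1) * direction p q v = 0 := by
    have : angle p q * (p + q - 1) = -((exchange p q v) * (cosAngle p q) * angle p q) := by
      rw [hb, ← mul_assoc, mul_assoc _ (cosAngle p q), ← hθm.eq, ← mul_assoc, hSθ, neg_mul,
        neg_neg]
    rw [direction, mul_assoc, this, ← mul_assoc (p + q - 1), hbS, mul_neg, ← mul_assoc,
      ← mul_assoc, hSS, one_mul]
    abel
  have e3 : direction p q v * (2 * p - 1) + (2 * p - 1) * direction p q v = 0 := by
    rw [show 2 * p - 1 = (p - q) + (p + q - 1) by rw [two_mul]; abel, mul_add, add_mul]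
    linear_combination (norm := module) e1 + e2
  refine smul_right_injective _ (two_ne_zero' ℂ) ?_
  simp only [mul_sub, sub_mul, two_mul, mul_add, add_mul, mul_one, one_mul] at e3
  linear_combination (norm := module) e3

theorem norm_direction_le (hp : IsStarProjection p) (hq : IsStarProjection q)
    (h1 : star v * v = projInf p (1 - q)) (h2 : v * star v = projInf (1 - p) q) :
    ‖direction p q v‖ ≤ ‖angle p q‖ := by
  have hS : exchange p q v ∈ unitary (H →L[ℂ] H) := by
    simp [Unitary.mem_iff, isSelfAdjoint_exchange.star_eq, exchange_mul_self hp hq h1 h2]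
  exact (CStarRing.norm_mem_unitary_mul _ hS).le

theorem direction_mem {A : VonNeumannAlgebra H} (hp : p ∈ projectionSet A)
    (hq : q ∈ projectionSet A) (hv : v ∈ A) : direction p q v ∈ A :=
  mul_mem (exchange_mem hp hq hv) (VonNeumannAlgebra.cfc_mem
    (hp.2.isSelfAdjoint.sub hq.2.isSelfAdjoint) (sub_mem hp.1 hq.1) _)

theorem exp_direction_conj (hp : IsStarProjection p) (hq : IsStarProjection q)
    (h1 : star v * v = projInf p (1 - q)) (h2 : v * star v = projInf (1 - p) q) :
    NormedSpace.exp (direction p q v) * p * NormedSpace.exp (-direction p q v) = q := by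
  have hpp : p * p = p := hp.isIdempotentElem
  have hSS := exchange_mul_self hp hq h1 h2
  have hεS : NormedSpace.exp (-direction p q v) = (2 * p - 1) * exchange p q v := by
    rw [← star_direction hp hq h1 h2, ← NormedSpace.star_exp, exp_direction hp hq h1 h2, star_mul,
      isSelfAdjoint_exchange.star_eq]
    simp [hp.isSelfAdjoint.star_eq, two_mul]
  have hεp : (2 * p - 1) * p * (2 * p - 1) = p := by
    simp only [mul_sub, sub_mul, two_mul, mul_add, add_mul, mul_one, one_mul, hpp]
    abel
  have hSa := exchange_mul_sub hp hq h1 h2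
  have hSb := exchange_mul_add_sub_one hp hq h1 h2
  have hbS : (p + q - 1) * exchange p q v = cosAngle p q := by
    have := congrArg star hSb
    rwa [star_mul, isSelfAdjoint_exchange.star_eq, isSelfAdjoint_cosAngle.star_eq,
      (isSelfAdjoint_add_sub_one hp hq).star_eq] at this
  have hSb' : exchange p q v * (p + q - 1) = (p + q - 1) * exchange p q v := by rw [hSb, hbS]
  have hSp : exchange p q v * p = q * exchange p q v := by
    refine smul_right_injective _ (two_ne_zero' ℂ) ?_
    simp only [mul_sub, sub_mul, mul_add, add_mul, mul_one, one_mul] at hSa hSb' ⊢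
    linear_combination (norm := module) hSa + hSb'
  rw [exp_direction hp hq h1 h2, hεS]
  calc exchange p q v * (2 * p - 1) * p * ((2 * p - 1) * exchange p q v)
      = exchange p q v * ((2 * p - 1) * p * (2 * p - 1)) * exchange p q v := by noncomm_ring
    _ = q := by rw [hεp, hSp, mul_assoc, hSS, mul_one]

end Symmetry

section Geodesics

variable {H : Type*} [NormedAddCommGroup H] [InnerProductSpace ℂ H] [CompleteSpace H]
  {A : VonNeumannAlgebra H} {p q z : H →L[ℂ] H}

/-- The orbit of `p` under the one-parameter group generated by `z`. -/
noncomputable def orbitCurve (z p : H →L[ℂ] H) (t : ℝ) : H →L[ℂ] H :=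
  NormedSpace.exp (t • z) * p * NormedSpace.exp (-(t • z))

theorem exp_mul_exp_neg (x : H →L[ℂ] H) : NormedSpace.exp x * NormedSpace.exp (-x) = 1 := by
  let +nondep : NormedAlgebra ℚ (H →L[ℂ] H) := .restrictScalars ℚ ℂ _
  rw [← NormedSpace.exp_add_of_commute (Commute.refl x).neg_right, add_neg_cancel,
    NormedSpace.exp_zero]

theorem exp_neg_mul_exp (x : H →L[ℂ] H) : NormedSpace.exp (-x) * NormedSpace.exp x = 1 := by
  simpa using exp_mul_exp_neg (-x)

theorem orbitCurve_zero : orbitCurve z p 0 = p := by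
  simp [orbitCurve]

theorem orbitCurve_one : orbitCurve z p 1 = NormedSpace.exp z * p * NormedSpace.exp (-z) := by
  simp [orbitCurve]

theorem contDiff_orbitCurve : ContDiff ℝ ∞ (orbitCurve z p) := by
  have hexp : ContDiff ℝ ∞ (NormedSpace.exp : (H →L[ℂ] H) → H →L[ℂ] H) :=
    contDiff_iff_contDiffAt.2 fun x => (NormedSpace.exp_analytic (𝕂 := ℝ) x).contDiffAt
  have h1 : ContDiff ℝ ∞ fun t : ℝ => t • z := contDiff_id.smul contDiff_const
  exact ((hexp.comp h1).mul contDiff_const).mul (hexp.comp h1.neg)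

theorem hasDerivAt_orbitCurve (t : ℝ) :
    HasDerivAt (orbitCurve z p) (z * orbitCurve z p t - orbitCurve z p t * z) t := by
  have h1 := hasDerivAt_exp_smul_const' (𝕂 := ℝ) z t
  have h2 := hasDerivAt_exp_smul_const (𝕂 := ℝ) (-z) t
  simp only [smul_neg] at h2
  refine ((h1.mul_const p).mul h2).congr_deriv ?_
  simp only [orbitCurve]
  noncomm_ring

theorem mul_conj_add_conj_mul {R : Type*} [Ring R] {z p u u' : R} (hu : z * u = u * z)
    (hu' : z * u' = u' * z) (huu' : u * u' = 1) (h : z * p + p * z = z) :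
    z * (u * p * u') + u * p * u' * z = z := by
  calc z * (u * p * u') + u * p * u' * z
      = (z * u) * p * u' + u * p * (u' * z) := by simp only [mul_assoc]
    _ = u * (z * p + p * z) * u' := by
        rw [hu, ← hu']
        simp only [mul_add, add_mul, mul_assoc]
    _ = z := by rw [h, ← hu, mul_assoc, huu', mul_one]

theorem mul_orbitCurve_add (h : z * p + p * z = z) (t : ℝ) :
    z * orbitCurve z p t + orbitCurve z p t * z = z := by
  have hc : Commute z (t • z) := (Commute.refl z).smul_right t
  exact mul_conj_add_conj_mul hc.exp_right hc.neg_right.exp_right (exp_mul_exp_neg _) h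

theorem deriv_orbitCurve (h : z * p + p * z = z) (t : ℝ) :
    deriv (orbitCurve z p) t = z * (2 * orbitCurve z p t - 1) := by
  rw [(hasDerivAt_orbitCurve (z := z) (p := p) t).deriv]
  have h1 := mul_orbitCurve_add h t
  rw [mul_sub, two_mul, mul_add, mul_one]
  linear_combination (norm := module) -h1

theorem star_exp_smul (hz : star z = -z) (t : ℝ) :
    star (NormedSpace.exp (t • z)) = NormedSpace.exp (-(t • z)) := by
  rw [NormedSpace.star_exp, star_smul, hz, star_trivial, smul_neg]

theorem isStarProjection_orbitCurve (hp : IsStarProjection p) (hz : star z = -z) (t : ℝ) :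
    IsStarProjection (orbitCurve z p t) := by
  have hpp : p * p = p := hp.isIdempotentElem
  constructor
  · change orbitCurve z p t * orbitCurve z p t = orbitCurve z p t
    calc orbitCurve z p t * orbitCurve z p t
        = NormedSpace.exp (t • z) * p * (NormedSpace.exp (-(t • z)) * NormedSpace.exp (t • z)) * p *
          NormedSpace.exp (-(t • z)) := by simp only [orbitCurve, mul_assoc]
      _ = orbitCurve z p t := by
        rw [exp_neg_mul_exp, mul_one, mul_assoc _ p p, hpp, orbitCurve]
  · change star (orbitCurve z p t) = orbitCurve z p t
    rw [orbitCurve, star_mul, star_mul, ← star_exp_smul hz, star_star, hp.isSelfAdjoint.star_eq,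
      mul_assoc]

theorem orbitCurve_mem (hp : p ∈ projectionSet A) (hzA : z ∈ A) (hz : star z = -z) (t : ℝ) :
    orbitCurve z p t ∈ projectionSet A := by
  have h := VonNeumannAlgebra.real_smul_mem t hzA
  exact ⟨mul_mem (mul_mem (VonNeumannAlgebra.exp_mem h) hp.1)
    (VonNeumannAlgebra.exp_mem (neg_mem h)), isStarProjection_orbitCurve hp.2 hz t⟩

theorem isGeodesic_orbitCurve (hp : p ∈ projectionSet A) (hzA : z ∈ A) (hz : star z = -z)
    (h : z * p + p * z = z) : IsGeodesic A (orbitCurve z p) where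
  smooth := contDiff_orbitCurve
  mem := orbitCurve_mem hp hzA hz
  parallel t := by
    have h1 := mul_orbitCurve_add h t
    have hid : orbitCurve z p t * orbitCurve z p t = orbitCurve z p t :=
      (isStarProjection_orbitCurve hp.2 hz t).isIdempotentElem
    have hd : deriv (orbitCurve z p) = fun t => z * (2 * orbitCurve z p t - 1) :=
      funext (deriv_orbitCurve h)
    have hd2 : deriv (deriv (orbitCurve z p)) t =
        z * (2 * (z * (2 * orbitCurve z p t - 1))) := by
      rw [hd]
      have := (hasDerivAt_orbitCurve (z := z) (p := p) t).differentiableAt.hasDerivAt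
      rw [deriv_orbitCurve h] at this
      exact (((this.const_mul 2).sub_const 1).const_mul z).deriv
    set d := orbitCurve z p t
    have hzd : z * d = z - d * z := eq_sub_of_add_eq h1
    have hdzd : d * z * d = 0 := by
      rw [mul_assoc, hzd, mul_sub, ← mul_assoc, hid, sub_self]
    have hzzd : z * z * d = d * z * z := by
      rw [mul_assoc, hzd, mul_sub, ← mul_assoc, hzd]; noncomm_ring
    have hdd : deriv (deriv (orbitCurve z p)) t * d = d * deriv (deriv (orbitCurve z p)) t := by
      rw [hd2]
      have e1 : z * (2 * (z * (2 * d - 1))) = 4 * (z * z * d) - 2 * (z * z) := by noncomm_ring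
      have e2 : z * z * d * d = d * (z * z * d) := by
        conv_lhs => rw [hzzd]
        noncomm_ring
      rw [e1, sub_mul, mul_sub, mul_assoc, e2]
      rw [show d * (4 * (z * z * d)) = 4 * (d * (z * z * d)) by noncomm_ring,
        show 2 * (z * z) * d = 2 * (z * z * d) by noncomm_ring,
        show d * (2 * (z * z)) = 2 * (d * z * z) by noncomm_ring, hzzd]
    rw [covariantDeriv]
    rw [← hdd, mul_assoc, mul_sub, mul_one, hid, sub_self, mul_zero, zero_add, mul_assoc, hdd,
      ← mul_assoc, sub_mul, one_mul, hid, sub_self, zero_mul]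

theorem norm_mul_symmetry (hp : IsStarProjection p) (x : H →L[ℂ] H) :
    ‖x * (2 * p - 1)‖ = ‖x‖ :=
  CStarRing.norm_mul_mem_unitary _ (symmetry_mem_unitary hp)

theorem norm_deriv_orbitCurve (hp : IsStarProjection p) (hz : star z = -z)
    (h : z * p + p * z = z) (t : ℝ) : ‖deriv (orbitCurve z p) t‖ = ‖z‖ := by
  rw [deriv_orbitCurve h, norm_mul_symmetry (isStarProjection_orbitCurve hp hz t)]

theorem curveLength_orbitCurve (hp : IsStarProjection p) (hz : star z = -z)
    (h : z * p + p * z = z) : curveLength (orbitCurve z p) 0 1 = ‖z‖ := by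
  have : Set.EqOn (fun t => ‖derivWithin (orbitCurve z p) (Set.Icc 0 1) t‖) (fun _ => ‖z‖)
      (Set.uIcc (0 : ℝ) 1) := by
    intro t ht
    rw [Set.uIcc_of_le zero_le_one] at ht
    have hd : derivWithin (orbitCurve z p) (Set.Icc 0 1) t = deriv (orbitCurve z p) t :=
      (contDiff_orbitCurve.differentiable (by simp) t).derivWithin
        (uniqueDiffOn_Icc zero_lt_one t ht)
    change ‖_‖ = _
    rw [hd, norm_deriv_orbitCurve hp hz h]
  rw [curveLength, intervalIntegral.integral_congr this]
  simp

theorem eq_of_orbitCurve_eq {z₁ z₂ : H →L[ℂ] H} (hp : IsStarProjection p)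
    (h1 : z₁ * p + p * z₁ = z₁) (h2 : z₂ * p + p * z₂ = z₂)
    (h : orbitCurve z₁ p = orbitCurve z₂ p) : z₁ = z₂ := by
  have hd : deriv (orbitCurve z₁ p) 0 = deriv (orbitCurve z₂ p) 0 := by rw [h]
  rw [deriv_orbitCurve h1, deriv_orbitCurve h2, orbitCurve_zero, orbitCurve_zero] at hd
  rw [← sub_eq_zero, ← norm_eq_zero, ← norm_mul_symmetry hp, sub_mul, hd, sub_self, norm_zero]

/-- Every geodesic is the orbit of its starting point under a one-parameter group of unitaries
of the algebra, with codiagonal generator. -/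
theorem IsGeodesic.exists_eq_orbitCurve {δ : ℝ → H →L[ℂ] H} (hδ : IsGeodesic A δ) :
    ∃ z ∈ A, star z = -z ∧ z * δ 0 + δ 0 * z = z ∧ δ = orbitCurve z (δ 0) := by
  have hdiff : Differentiable ℝ δ := hδ.smooth.differentiable (by simp)
  have hdiff' : Differentiable ℝ (deriv δ) :=
    (contDiff_infty_iff_deriv.1 hδ.smooth).2.differentiable (by simp)
  have hid (t : ℝ) : δ t * δ t = δ t := (hδ.mem t).2.isIdempotentElem
  have hd (t : ℝ) : HasDerivAt δ (deriv δ t) t := (hdiff t).hasDerivAt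
  have hdd (t : ℝ) : HasDerivAt (deriv δ) (deriv (deriv δ) t) t := (hdiff' t).hasDerivAt
  have hcod (t : ℝ) : deriv δ t * δ t + δ t * deriv δ t = deriv δ t := by
    have h1 : HasDerivAt (fun t => δ t * δ t) _ t := (hd t).mul (hd t)
    rw [funext hid] at h1
    exact h1.unique (hd t)
  have hcomm (t : ℝ) : deriv (deriv δ) t * δ t = δ t * deriv (deriv δ) t := by
    have h := hδ.parallel t
    rw [covariantDeriv] at h
    have h1 : δ t * deriv (deriv δ) t * (1 - δ t) = 0 := by
      have := congrArg (δ t * ·) h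
      simp only [mul_add, mul_zero, ← mul_assoc, mul_sub, mul_one, hid, sub_self, zero_mul,
        add_zero] at this
      simpa only [mul_sub, mul_one] using this
    have h2 : (1 - δ t) * deriv (deriv δ) t * δ t = 0 := by
      rwa [h1, zero_add] at h
    rw [mul_sub, mul_one, sub_eq_zero] at h1
    rw [sub_mul, sub_mul, one_mul, sub_eq_zero] at h2
    rw [h1, h2]
  obtain ⟨z, hz⟩ : ∃ z, ∀ t, deriv δ t * δ t - δ t * deriv δ t = z := by
    have hder (t : ℝ) : HasDerivAt (fun t => deriv δ t * δ t - δ t * deriv δ t) 0 t := by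
      refine (((hdd t).mul (hd t)).sub ((hd t).mul (hdd t))).congr_deriv ?_
      rw [hcomm]
      abel
    exact ⟨_, fun t => is_const_of_deriv_eq_zero (fun t => (hder t).differentiableAt)
      (fun t => (hder t).deriv) t 0⟩
  have hdzd (t : ℝ) : δ t * deriv δ t * δ t = 0 := by
    have := congrArg (δ t * ·) (hcod t)
    simpa only [mul_add, ← mul_assoc, hid, add_eq_right] using this
  have hzcod (t : ℝ) : z * δ t + δ t * z = z := by
    rw [← hz t, sub_mul, mul_sub, mul_assoc, hid, hdzd, ← mul_assoc, hdzd, ← mul_assoc, hid]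
    abel
  have hzd (t : ℝ) : deriv δ t = z * δ t - δ t * z := by
    rw [← hz t, sub_mul, mul_sub, mul_assoc, hid, hdzd, ← mul_assoc, hdzd, ← mul_assoc, hid,
      sub_zero, zero_sub, sub_neg_eq_add, hcod]
  have hstar : star z = -z := by
    have hsa : star (deriv δ 0) = deriv δ 0 := by
      have h1 : HasDerivAt (fun t => star (δ t)) _ 0 := (hd 0).star
      rw [funext fun t => (hδ.mem t).2.isSelfAdjoint.star_eq] at h1
      exact h1.unique (hd 0)
    rw [← hz 0, star_sub, star_mul, star_mul, hsa, (hδ.mem 0).2.isSelfAdjoint.star_eq, neg_sub]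
  have hzA : z ∈ A := by
    refine VonNeumannAlgebra.mem_of_commute fun y hy => ?_
    have hc (t : ℝ) : y * δ t = δ t * y := VonNeumannAlgebra.commute_of_mem hy (hδ.mem t).1
    have hc' : Commute y (deriv δ 0) := by
      have h1 := (hd 0).const_mul y
      have h2 := (hd 0).mul_const y
      rw [← funext hc] at h2
      exact h1.unique h2
    rw [← hz 0]
    exact (hc'.mul_right (hc 0)).sub_right (Commute.mul_right (hc 0) hc')
  refine ⟨z, hzA, hstar, hzcod 0, ?_⟩
  have hconst (t : ℝ) : NormedSpace.exp (-(t • z)) * δ t * NormedSpace.exp (t • z) = δ 0 := by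
    have hder (t : ℝ) : HasDerivAt
        (fun t : ℝ => NormedSpace.exp (-(t • z)) * δ t * NormedSpace.exp (t • z)) 0 t := by
      have h1 := hasDerivAt_exp_smul_const' (𝕂 := ℝ) z t
      have h2 := hasDerivAt_exp_smul_const (𝕂 := ℝ) (-z) t
      simp only [smul_neg] at h2
      refine ((h2.mul (hd t)).mul h1).congr_deriv ?_
      rw [hzd]
      simp only [Pi.mul_apply]
      noncomm_ring
    have := is_const_of_deriv_eq_zero (fun t => (hder t).differentiableAt)
      (fun t => (hder t).deriv) t 0
    simpa using this
  ext1 t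
  rw [orbitCurve, ← hconst t]
  calc δ t = (NormedSpace.exp (t • z) * NormedSpace.exp (-(t • z))) * δ t *
        (NormedSpace.exp (t • z) * NormedSpace.exp (-(t • z))) := by
        rw [exp_mul_exp_neg, one_mul, mul_one]
    _ = _ := by simp only [mul_assoc]

end Geodesics

section Minimality

variable {H : Type*} [NormedAddCommGroup H] [InnerProductSpace ℂ H]

/-- A curve `x` on the unit sphere has speed at least the rate of change of its angle with a fixed
unit vector `η`. -/
theorem abs_re_inner_le_mul_sqrt {x x' η : H} (hx : ‖x‖ = 1) (hη : ‖η‖ = 1)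
    (htan : (inner ℂ x' x).re = 0) :
    |(inner ℂ x' η).re| ≤ ‖x'‖ * √(1 - (inner ℂ x η).re ^ 2) := by
  set c : ℝ := (inner ℂ x η).re with hc
  have h1 : (inner ℂ x' η).re = (inner ℂ x' (η - (c : ℂ) • x)).re := by
    rw [inner_sub_right, inner_smul_right, Complex.sub_re, Complex.re_ofReal_mul, htan, mul_zero,
      sub_zero]
  have h2 : ‖η - (c : ℂ) • x‖ ^ 2 = 1 - c ^ 2 := by
    rw [@norm_sub_sq ℂ, inner_smul_right, norm_smul, hx, hη]
    have : RCLike.re ((c : ℂ) * inner ℂ η x) = c * c := by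
      rw [← inner_conj_symm]
      change ((c : ℂ) * _).re = _
      rw [Complex.re_ofReal_mul, Complex.conj_re]
    rw [this, Complex.norm_real, Real.norm_eq_abs, mul_one, sq_abs]
    ring
  have h3 : ‖η - (c : ℂ) • x‖ = √(1 - c ^ 2) := by
    rw [← h2, Real.sqrt_sq (norm_nonneg _)]
  rw [h1, ← h3]
  exact (Complex.abs_re_le_norm _).trans (norm_inner_le_norm _ _)

variable [CompleteSpace H]

theorem norm_symmetry_apply {p : H →L[ℂ] H} (hp : IsStarProjection p) (ξ : H) :
    ‖(2 * p - 1) ξ‖ = ‖ξ‖ :=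
  ContinuousLinearMap.norm_map_of_mem_unitary (symmetry_mem_unitary hp) ξ

/-- The angle swept by a unit vector under the symmetries of a curve of projections is at most
twice the length of the curve. The factor `r < 1` keeps `arcsin` differentiable. -/
theorem arcsin_inner_sub_le_curveLength {γ : ℝ → H →L[ℂ] H} {a b : ℝ} (hab : a < b)
    (hγ : ContDiffOn ℝ 1 γ (Set.Icc a b)) (hproj : ∀ t ∈ Set.Icc a b, IsStarProjection (γ t))
    {ξ η : H} (hξ : ‖ξ‖ = 1) (hη : ‖η‖ = 1) {r : ℝ} (hr0 : 0 ≤ r) (hr1 : r < 1) :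
    Real.arcsin (r * (inner ℂ ((2 * γ a - 1) ξ) η).re) -
      Real.arcsin (r * (inner ℂ ((2 * γ b - 1) ξ) η).re) ≤ 2 * curveLength γ a b := by
  let x : ℝ → H := fun t => (2 * γ t - 1) ξ
  let c : ℝ → ℝ := fun t => (inner ℂ (x t) η).re
  have hx (t) (ht : t ∈ Set.Icc a b) : ‖x t‖ = 1 := by
    rw [norm_symmetry_apply (hproj t ht), hξ]
  have hcabs (t) (ht : t ∈ Set.Icc a b) : |c t| ≤ 1 := by
    refine (Complex.abs_re_le_norm _).trans ((norm_inner_le_norm _ _).trans ?_)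
    rw [hx t ht, hη, mul_one]
  have hrc (t) (ht : t ∈ Set.Icc a b) : |r * c t| < 1 := by
    rw [abs_mul, abs_of_nonneg hr0]
    nlinarith [hcabs t ht, abs_nonneg (c t)]
  have hxcont : ContinuousOn x (Set.Icc a b) :=
    ((continuousOn_const.mul hγ.continuousOn).sub continuousOn_const).clm_apply continuousOn_const
  have hccont : ContinuousOn c (Set.Icc a b) :=
    Complex.continuous_re.comp_continuousOn (hxcont.inner continuousOn_const)
  let γ' : ℝ → H →L[ℂ] H := fun t => derivWithin γ (Set.Icc a b) t
  let x' : ℝ → H := fun t => (2 * γ' t) ξ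
  have hγ'cont : ContinuousOn γ' (Set.Icc a b) :=
    hγ.continuousOn_derivWithin (uniqueDiffOn_Icc hab) le_rfl
  have hxd (t) (ht : t ∈ Set.Ioo a b) : HasDerivAt x (x' t) t := by
    have hd : HasDerivAt γ (γ' t) t :=
      ((hγ.differentiableOn (by simp)) t (Set.Ioo_subset_Icc_self ht)).hasDerivWithinAt.hasDerivAt
        (Icc_mem_nhds ht.1 ht.2)
    have h2 : HasDerivAt (fun s => 2 * γ s - 1) (2 * γ' t) t := (hd.const_mul 2).sub_const 1
    exact ((ContinuousLinearMap.apply ℂ H ξ).restrictScalars ℝ).hasFDerivAt.comp_hasDerivAt t h2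
  have hcd (t) (ht : t ∈ Set.Ioo a b) : HasDerivAt c (inner ℂ (x' t) η).re t := by
    have h := (hxd t ht).inner ℂ (hasDerivAt_const t η)
    exact (Complex.reCLM.hasFDerivAt.comp_hasDerivAt t h).congr_deriv (by simp)
  have htan (t) (ht : t ∈ Set.Ioo a b) : (inner ℂ (x' t) (x t)).re = 0 := by
    have h := (hxd t ht).inner ℂ (hxd t ht)
    have h2 := Complex.reCLM.hasFDerivAt.comp_hasDerivAt t h
    have h3 : (Complex.reCLM ∘ fun t => inner ℂ (x t) (x t)) =ᶠ[nhds t] fun _ => (1 : ℝ) := by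
      filter_upwards [Icc_mem_nhds ht.1 ht.2] with s hs
      have := inner_self_eq_norm_sq (𝕜 := ℂ) (x s)
      rw [hx s hs] at this
      simpa using this
    have h4 := (h2.congr_of_eventuallyEq h3.symm).unique (hasDerivAt_const t (1 : ℝ))
    have h5 : (inner ℂ (x t) (x' t)).re = (inner ℂ (x' t) (x t)).re := by
      rw [← inner_conj_symm, Complex.conj_re]
    simp only [Complex.reCLM_apply, Complex.add_re, h5] at h4
    linarith
  have hx'norm (t) : ‖x' t‖ ≤ 2 * ‖γ' t‖ := by
    have : x' t = (2 : ℂ) • γ' t ξ := by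
      simp only [x', two_mul, two_smul]
      rfl
    rw [this, norm_smul]
    have h := (γ' t).le_opNorm ξ
    rw [hξ, mul_one] at h
    simpa using h
  have hmain := intervalIntegral.sub_le_integral_of_hasDeriv_right_of_le
    (g := fun t => -Real.arcsin (r * c t))
    (g' := fun t => -(1 / √(1 - (r * c t) ^ 2) * (r * (inner ℂ (x' t) η).re)))
    (φ := fun t => 2 * ‖γ' t‖) hab.le
    (Real.continuous_arcsin.comp_continuousOn (continuousOn_const.mul hccont)).neg
    (fun t ht => by
      have hlt := abs_lt.1 (hrc t (Set.Ioo_subset_Icc_self ht))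
      have h1 := Real.hasDerivAt_arcsin (x := r * c t) hlt.1.ne' hlt.2.ne
      exact ((h1.comp t ((hcd t ht).const_mul r)).neg).hasDerivWithinAt)
    ((continuousOn_const.mul hγ'cont.norm).integrableOn_Icc)
    (fun t ht => by
      have ht' := Set.Ioo_subset_Icc_self ht
      have h1 := abs_re_inner_le_mul_sqrt (hx t ht') hη (htan t ht)
      have hlt := hrc t ht'
      have hpos : 0 < √(1 - (r * c t) ^ 2) := by
        refine Real.sqrt_pos.2 ?_
        nlinarith [abs_nonneg (r * c t), sq_abs (r * c t)]
      have hle : √(1 - c t ^ 2) ≤ √(1 - (r * c t) ^ 2) := by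
        refine Real.sqrt_le_sqrt ?_
        have hr : r ^ 2 ≤ 1 := pow_le_one₀ hr0 hr1.le
        nlinarith [mul_nonneg (sq_nonneg (c t)) (sub_nonneg.2 hr)]
      have h2 : |(inner ℂ (x' t) η).re| ≤ 2 * ‖γ' t‖ * √(1 - (r * c t) ^ 2) :=
        h1.trans (mul_le_mul (hx'norm t) hle (Real.sqrt_nonneg _) (by positivity))
      rw [← neg_mul, neg_div', div_mul_eq_mul_div, div_le_iff₀ hpos]
      have h3 : |r * (inner ℂ (x' t) η).re| ≤ |(inner ℂ (x' t) η).re| := by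
        rw [abs_mul, abs_of_nonneg hr0]
        exact mul_le_of_le_one_left (abs_nonneg _) hr1.le
      linarith [neg_abs_le (r * (inner ℂ (x' t) η).re)])
  rw [intervalIntegral.integral_const_mul] at hmain
  simp only [curveLength]
  linarith

/-- The length of a curve of projections is at least the angle between its endpoints. -/
theorem arcsin_norm_sub_le_curveLength {γ : ℝ → H →L[ℂ] H} {a b : ℝ} (hab : a < b)
    (hγ : ContDiffOn ℝ 1 γ (Set.Icc a b)) (hproj : ∀ t ∈ Set.Icc a b, IsStarProjection (γ t)) :
    Real.arcsin ‖γ a - γ b‖ ≤ curveLength γ a b := by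
  have ha := hproj a (Set.left_mem_Icc.2 hab.le)
  have hb := hproj b (Set.right_mem_Icc.2 hab.le)
  have hL0 : 0 ≤ curveLength γ a b :=
    intervalIntegral.integral_nonneg hab.le fun _ _ => norm_nonneg _
  rcases le_or_gt (Real.pi / 2) (curveLength γ a b) with hL | hL
  · exact (Real.arcsin_le_pi_div_two _).trans hL
  have hsin0 : 0 ≤ Real.sin (curveLength γ a b) :=
    Real.sin_nonneg_of_nonneg_of_le_pi hL0 (by linarith [Real.pi_pos])
  rw [Real.arcsin_le_iff_le_sin' ⟨by linarith [Real.pi_pos], hL⟩]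
  refine ContinuousLinearMap.opNorm_le_of_unit_norm hsin0 fun ξ hξ => ?_
  have hη : ‖(2 * γ a - 1) ξ‖ = 1 := by rw [norm_symmetry_apply ha, hξ]
  set η := (2 * γ a - 1) ξ with hηdef
  set c := (inner ℂ ((2 * γ b - 1) ξ) η).re with hc
  have hlim : Real.arcsin 1 - Real.arcsin c ≤ 2 * curveLength γ a b := by
    have key : ∀ᶠ r in nhdsWithin (1 : ℝ) (Set.Iio 1),
        Real.arcsin (r * 1) - Real.arcsin (r * c) ≤ 2 * curveLength γ a b := by
      have h0 : ∀ᶠ r in nhdsWithin (1 : ℝ) (Set.Iio 1), (0 : ℝ) ≤ r :=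
        nhdsWithin_le_nhds (Ici_mem_nhds zero_lt_one)
      filter_upwards [h0, self_mem_nhdsWithin] with r hr0 hr1
      have := arcsin_inner_sub_le_curveLength hab hγ hproj hξ hη hr0 hr1
      have h1 : (inner ℂ η η).re = 1 := by
        have := inner_self_eq_norm_sq (𝕜 := ℂ) η
        rw [hη] at this
        simpa using this
      rwa [← hηdef, h1] at this
    have hcont : Continuous fun r : ℝ => Real.arcsin (r * 1) - Real.arcsin (r * c) := by
      have := Real.continuous_arcsin
      fun_prop
    have htend := (hcont.tendsto 1).mono_left (nhdsWithin_le_nhds (s := Set.Iio 1))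
    simp only [one_mul] at htend
    exact le_of_tendsto htend key
  rw [Real.arcsin_one] at hlim
  have hcos : Real.cos (2 * curveLength γ a b) ≤ c := by
    have h1 : Real.arccos c ≤ 2 * curveLength γ a b := hlim
    have hc1 : |c| ≤ 1 := by
      refine (Complex.abs_re_le_norm _).trans ((norm_inner_le_norm _ _).trans ?_)
      rw [norm_symmetry_apply hb, hξ, hη, mul_one]
    rw [← Real.cos_arccos (abs_le.1 hc1).1 (abs_le.1 hc1).2]
    exact Real.cos_le_cos_of_nonneg_of_le_pi (Real.arccos_nonneg c) (by linarith) h1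
  have hnorm : ‖(2 * γ b - 1) ξ - η‖ ^ 2 = 2 - 2 * c := by
    rw [@norm_sub_sq ℂ, norm_symmetry_apply hb, hξ, hη]
    change _ - 2 * c + _ = _
    ring
  have hdiff : (2 * γ b - 1) ξ - η = -((2 : ℂ) • (γ a - γ b) ξ) := by
    simp only [hηdef, two_mul, two_smul, sub_apply, add_apply]
    abel
  rw [hdiff, norm_neg, norm_smul, Complex.norm_ofNat, mul_pow] at hnorm
  rw [Real.cos_two_mul, Real.cos_sq'] at hcos
  refine abs_le_of_sq_le_sq' ?_ hsin0 |>.2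
  nlinarith

end Minimality

section Endpoints

variable {H : Type*} [NormedAddCommGroup H] [InnerProductSpace ℂ H]
  {p q z : H →L[ℂ] H}

theorem symmetry_mul_eq_iff {x : H →L[ℂ] H} :
    ((2 * p - 1) * x = x ↔ p * x = x) ∧ ((2 * p - 1) * x = -x ↔ p * x = 0) := by
  have h : (2 * p - 1) * x = (2 : ℂ) • (p * x) - x := by
    rw [sub_mul, one_mul, two_mul, add_mul, two_smul]
  rw [h]
  constructor
  · rw [sub_eq_iff_eq_add, ← two_smul ℂ x, (smul_right_injective _ (two_ne_zero' ℂ)).eq_iff]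
  · rw [sub_eq_neg_self, smul_eq_zero_iff_right (two_ne_zero' ℂ)]

variable [CompleteSpace H] {A : VonNeumannAlgebra H}

theorem symmetry_mul_exp_neg (h : z * p + p * z = z) :
    (2 * p - 1) * NormedSpace.exp (-z) = NormedSpace.exp z * (2 * p - 1) := by
  let +nondep : NormedAlgebra ℚ (H →L[ℂ] H) := .restrictScalars ℚ ℂ _
  have hs : SemiconjBy (2 * p - 1) (-z) z := by
    simp only [SemiconjBy, sub_mul, mul_sub, two_mul, add_mul, mul_add, one_mul, mul_one, mul_neg]
    linear_combination (norm := module) (-2 : ℂ) • h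
  exact hs.exp_right

theorem exp_mul_symmetry_mul_exp_neg (hq : NormedSpace.exp z * p * NormedSpace.exp (-z) = q) :
    NormedSpace.exp z * (2 * p - 1) * NormedSpace.exp (-z) = 2 * q - 1 := by
  rw [mul_sub, sub_mul, mul_one, exp_mul_exp_neg, two_mul, two_mul, mul_add, add_mul, hq]

theorem exp_mul_exp_mul_symmetry (h : z * p + p * z = z)
    (hq : NormedSpace.exp z * p * NormedSpace.exp (-z) = q) :
    NormedSpace.exp z * NormedSpace.exp z * (2 * p - 1) = 2 * q - 1 := by
  rw [mul_assoc, ← symmetry_mul_exp_neg h, ← mul_assoc, exp_mul_symmetry_mul_exp_neg hq]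

theorem exp_mul_exp_eq (hp : IsStarProjection p) (h : z * p + p * z = z)
    (hq : NormedSpace.exp z * p * NormedSpace.exp (-z) = q) :
    NormedSpace.exp z * NormedSpace.exp z = (2 * q - 1) * (2 * p - 1) := by
  rw [← exp_mul_exp_mul_symmetry h hq, mul_assoc _ (2 * p - 1), symmetry_mul_self hp, mul_one]

theorem exp_neg_mul_exp_neg_eq (hp : IsStarProjection p) (h : z * p + p * z = z)
    (hq : NormedSpace.exp z * p * NormedSpace.exp (-z) = q) :
    NormedSpace.exp (-z) * NormedSpace.exp (-z) = (2 * p - 1) * (2 * q - 1) := by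
  rw [← exp_mul_symmetry_mul_exp_neg hq, ← symmetry_mul_exp_neg h, mul_assoc (2 * p - 1),
    ← mul_assoc (2 * p - 1), symmetry_mul_self hp, one_mul]

theorem exp_mul_of_symmetry_mul (hp : IsStarProjection p) (h : z * p + p * z = z)
    (hq : NormedSpace.exp z * p * NormedSpace.exp (-z) = q) {x : H →L[ℂ] H} {c : ℂ}
    (hc : c * c = 1) (hpx : (2 * p - 1) * x = c • x) (hqx : (2 * q - 1) * x = -(c • x)) :
    NormedSpace.exp (-z) * x = -(NormedSpace.exp z * x) ∧
    (2 * p - 1) * (NormedSpace.exp z * x) = -(c • (NormedSpace.exp z * x)) ∧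
    (2 * q - 1) * (NormedSpace.exp z * x) = c • (NormedSpace.exp z * x) := by
  have hUU : NormedSpace.exp z * NormedSpace.exp z * x = -x := by
    rw [exp_mul_exp_eq hp h hq, mul_assoc, hpx, mul_smul_comm, hqx, smul_neg, smul_smul, hc,
      one_smul]
  have hinv : NormedSpace.exp (-z) * x = -(NormedSpace.exp z * x) := by
    have h1 := congrArg (NormedSpace.exp (-z) * ·) hUU
    simp only [mul_assoc] at h1
    rw [← mul_assoc, exp_neg_mul_exp, one_mul, mul_neg] at h1
    rw [h1, neg_neg]
  have hp' : (2 * p - 1) * (NormedSpace.exp z * x) = -(c • (NormedSpace.exp z * x)) := by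
    rw [← neg_eq_iff_eq_neg.2 hinv, mul_neg, ← mul_assoc, symmetry_mul_exp_neg h, mul_assoc, hpx,
      mul_smul_comm, neg_eq_iff_eq_neg.2 hinv]
  refine ⟨hinv, hp', ?_⟩
  rw [← exp_mul_exp_mul_symmetry h hq, mul_assoc, hp', mul_neg, mul_smul_comm, mul_assoc,
    ← mul_assoc _ _ x, hUU, mul_neg, smul_neg, neg_neg]

/-- The end of a geodesic from `p` to `q` implements an equivalence between `p ∧ q^⊥` and
`p^⊥ ∧ q`. -/
theorem mvNEquiv_of_exp_conj (hp : p ∈ projectionSet A) (hq : q ∈ projectionSet A) (hzA : z ∈ A)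
    (hz : star z = -z) (h : z * p + p * z = z)
    (hpq : NormedSpace.exp z * p * NormedSpace.exp (-z) = q) :
    MvNEquiv A (projInf p (1 - q)) (projInf (1 - p) q) := by
  have hstar : star (NormedSpace.exp z) = NormedSpace.exp (-z) := by
    simpa using star_exp_smul hz 1
  have hE := isStarProjection_projInf p (1 - q)
  have hF := isStarProjection_projInf (1 - p) q
  obtain ⟨e1, e2⟩ := mul_projInf_compl_right hp.2 hq.2
  obtain ⟨f1, f2⟩ := mul_projInf_compl_left hp.2 hq.2
  obtain ⟨-, he1, he2⟩ := exp_mul_of_symmetry_mul hp.2 h hpq (x := projInf p (1 - q)) (c := 1)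
    (by norm_num) (by rw [one_smul]; exact symmetry_mul_eq_iff.1.2 e1)
    (by rw [one_smul]; exact symmetry_mul_eq_iff.2.2 e2)
  obtain ⟨hinv, hf1, hf2⟩ := exp_mul_of_symmetry_mul hp.2 h hpq (x := projInf (1 - p) q) (c := -1)
    (by norm_num) (by rw [neg_one_smul]; exact symmetry_mul_eq_iff.2.2 f1)
    (by rw [neg_one_smul, neg_neg]; exact symmetry_mul_eq_iff.1.2 f2)
  rw [one_smul] at he1 he2
  rw [neg_one_smul] at hf1 hf2
  rw [neg_neg] at hf1
  set U := NormedSpace.exp z with hU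
  set e := projInf p (1 - q) with he
  set f := projInf (1 - p) q with hf
  have hfUe : f * (U * e) = U * e :=
    projInf_mul_eq_self (by rw [sub_mul, one_mul, symmetry_mul_eq_iff.2.1 he1, sub_zero])
      (symmetry_mul_eq_iff.1.1 he2)
  have heUf : e * (U * f) = U * f :=
    projInf_mul_eq_self (symmetry_mul_eq_iff.1.1 hf1)
      (by rw [sub_mul, one_mul, symmetry_mul_eq_iff.2.1 hf2, sub_zero])
  have hee : e * e = e := hE.isIdempotentElem
  have hUeUf : U * e * NormedSpace.exp (-z) * f = f := by
    rw [mul_assoc, hinv, mul_neg, mul_assoc, heUf, ← mul_neg, ← hinv, ← mul_assoc, hU,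
      exp_mul_exp_neg, one_mul]
  refine ⟨U * e, mul_mem (VonNeumannAlgebra.exp_mem hzA)
    (projInf_mem hp (one_sub_mem_projectionSet hq)), ?_, ?_⟩
  · rw [star_mul, hE.isSelfAdjoint.star_eq, hstar, mul_assoc, ← mul_assoc _ U, hU, exp_neg_mul_exp,
      one_mul, hee]
  · have h1 : U * e * star (U * e) = U * e * NormedSpace.exp (-z) := by
      rw [star_mul, hE.isSelfAdjoint.star_eq, hstar, ← mul_assoc, mul_assoc U, hee]
    have h2 : f * (U * e * NormedSpace.exp (-z)) = U * e * NormedSpace.exp (-z) := by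
      rw [← mul_assoc, hfUe]
    have h3 := congrArg star h2
    rw [← h1, star_mul, star_mul (U * e), star_star, hF.isSelfAdjoint.star_eq, h1, hUeUf] at h3
    rw [h1, h3]

end Endpoints

section Uniqueness

variable {H : Type*} [NormedAddCommGroup H] [InnerProductSpace ℂ H] [CompleteSpace H]
  {p q z : H →L[ℂ] H}

theorem add_sub_one_mul_self_eq (hp : IsStarProjection p) (hq : IsStarProjection q) :
    (2 * q - 1) * (2 * p - 1) + (2 * p - 1) * (2 * q - 1) + (2 : ℂ) • 1 =
      (4 : ℂ) • ((p + q - 1) * (p + q - 1)) := by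
  have hpp : p * p = p := hp.isIdempotentElem
  have hqq : q * q = q := hq.isIdempotentElem
  simp only [mul_sub, sub_mul, two_mul, mul_add, add_mul, mul_one, one_mul, hpp, hqq]
  module

theorem cos_and_sin_of_exp_conj (hp : IsStarProjection p) (hq : IsStarProjection q)
    (h : z * p + p * z = z) (hpq : NormedSpace.exp z * p * NormedSpace.exp (-z) = q)
    {x : H →L[ℂ] H} (hx : IsSelfAdjoint x) (hzx : z = Complex.I • x) :
    cfc Real.cos x * cfc Real.cos x = (p + q - 1) * (p + q - 1) ∧
    (4 * Complex.I) • (cfc Real.cos x * cfc Real.sin x) =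
      (2 * q - 1) * (2 * p - 1) - (2 * p - 1) * (2 * q - 1) := by
  have hU : NormedSpace.exp z = cfc Real.cos x + Complex.I • cfc Real.sin x := by
    rw [hzx, exp_I_smul_eq_cos_add_sin hx]
  have hU' : NormedSpace.exp (-z) = cfc Real.cos x - Complex.I • cfc Real.sin x := by
    rw [hzx, exp_neg_I_smul_eq_cos_sub_sin hx]
  have h1 := exp_mul_exp_eq hp h hpq
  have h2 := exp_neg_mul_exp_neg_eq hp h hpq
  have h3 := exp_mul_exp_neg z
  have hcs : Complex.I • cfc Real.sin x * cfc Real.cos x =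
      cfc Real.cos x * (Complex.I • cfc Real.sin x) := by
    rw [smul_mul_assoc, mul_smul_comm, (cfc_commute_cfc Real.sin Real.cos x).eq]
  have key {c j : H →L[ℂ] H} (hj : j * c = c * j) :
      (c + j) * (c + j) + (c - j) * (c - j) + (2 : ℂ) • ((c + j) * (c - j)) = (4 : ℂ) • (c * c) ∧
      (c + j) * (c + j) - (c - j) * (c - j) = (4 : ℂ) • (c * j) := by
    simp only [mul_add, add_mul, mul_sub, sub_mul, hj]
    constructor <;> module
  obtain ⟨k1, k2⟩ := key hcs
  rw [← hU, ← hU', h1, h2, h3, add_sub_one_mul_self_eq hp hq] at k1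
  rw [← hU, ← hU', h1, h2, mul_smul_comm, smul_smul] at k2
  exact ⟨(smul_right_injective _ (by norm_num : (4 : ℂ) ≠ 0) k1).symm, k2.symm⟩

theorem eq_arcsin_sin {x : H →L[ℂ] H} (hx : IsSelfAdjoint x) (hn : ‖x‖ ≤ Real.pi / 2) :
    cfc Real.arcsin (cfc Real.sin x) = x := by
  rw [← cfc_comp' Real.arcsin Real.sin x
    (hg := Real.continuous_arcsin.continuousOn) (hf := Real.continuous_sin.continuousOn)]
  conv_rhs => rw [← cfc_id' ℝ x]
  refine cfc_congr fun t ht => ?_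
  have := abs_le.1 ((abs_le_norm_of_mem_spectrum ht).trans hn)
  exact Real.arcsin_sin this.1 this.2

theorem cos_nonneg_of_norm_le {x : H →L[ℂ] H} (hn : ‖x‖ ≤ Real.pi / 2) :
    0 ≤ cfc Real.cos x :=
  cfc_nonneg fun _ ht => Real.cos_nonneg_of_mem_Icc
    (abs_le.1 ((abs_le_norm_of_mem_spectrum ht).trans hn))

/-- A unitary path between two projections in generic position has only one generator of norm at
most `π / 2`. -/
theorem generator_unique (hp : IsStarProjection p) (hq : IsStarProjection q)
    (he : projInf p (1 - q) = 0) (hf : projInf (1 - p) q = 0) {z₁ z₂ : H →L[ℂ] H}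
    (hz₁ : star z₁ = -z₁) (hz₂ : star z₂ = -z₂) (h₁ : z₁ * p + p * z₁ = z₁)
    (h₂ : z₂ * p + p * z₂ = z₂) (hpq₁ : NormedSpace.exp z₁ * p * NormedSpace.exp (-z₁) = q)
    (hpq₂ : NormedSpace.exp z₂ * p * NormedSpace.exp (-z₂) = q)
    (hn₁ : ‖z₁‖ ≤ Real.pi / 2) (hn₂ : ‖z₂‖ ≤ Real.pi / 2) : z₁ = z₂ := by
  have hsa {z : H →L[ℂ] H} (hz : star z = -z) : IsSelfAdjoint (-Complex.I • z) := by
    simp [IsSelfAdjoint, hz]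
  have hI {z : H →L[ℂ] H} : z = Complex.I • (-Complex.I • z) := by
    simp [smul_smul]
  have hnorm {z : H →L[ℂ] H} (hn : ‖z‖ ≤ Real.pi / 2) : ‖-Complex.I • z‖ ≤ Real.pi / 2 := by
    simpa [norm_smul] using hn
  obtain ⟨hc₁, hs₁⟩ := cos_and_sin_of_exp_conj hp hq h₁ hpq₁ (hsa hz₁) hI
  obtain ⟨hc₂, hs₂⟩ := cos_and_sin_of_exp_conj hp hq h₂ hpq₂ (hsa hz₂) hI
  have hcos : cfc Real.cos (-Complex.I • z₁) = cfc Real.cos (-Complex.I • z₂) := by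
    rw [← CFC.sqrt_unique hc₁ (cos_nonneg_of_norm_le (hnorm hn₁)),
      ← CFC.sqrt_unique hc₂ (cos_nonneg_of_norm_le (hnorm hn₂))]
  have hsin : cfc Real.sin (-Complex.I • z₁) = cfc Real.sin (-Complex.I • z₂) := by
    have h0 := smul_right_injective _ (mul_ne_zero (by norm_num : (4 : ℂ) ≠ 0) Complex.I_ne_zero)
      (hs₁.trans hs₂.symm)
    rw [hcos, ← sub_eq_zero, ← mul_sub] at h0
    set y := cfc Real.sin (-Complex.I • z₁) - cfc Real.sin (-Complex.I • z₂) with hy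
    have hb := isSelfAdjoint_add_sub_one hp hq
    have h1 : (p + q - 1) * ((p + q - 1) * y) = 0 := by
      rw [← mul_assoc, ← hc₂, mul_assoc, h0, mul_zero]
    have h2 : (p + q - 1) * y = 0 := by
      rw [← CStarRing.star_mul_self_eq_zero_iff, star_mul, hb.star_eq, mul_assoc, h1, mul_zero]
    have h3 := projInf_add_projInf_mul hp hq h2
    rw [he, hf, add_zero, zero_mul] at h3
    exact sub_eq_zero.1 h3.symm
  rw [hI (z := z₁), hI (z := z₂), ← eq_arcsin_sin (hsa hz₁) (hnorm hn₁), hsin,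
    eq_arcsin_sin (hsa hz₂) (hnorm hn₂)]

end Uniqueness

section Main

variable {H : Type*} [NormedAddCommGroup H] [InnerProductSpace ℂ H] [CompleteSpace H]
  {A : VonNeumannAlgebra H} {p q v : H →L[ℂ] H}

theorem isGeodesicJoining_direction (hp : p ∈ projectionSet A) (hq : q ∈ projectionSet A)
    (hv : v ∈ A) (h1 : star v * v = projInf p (1 - q)) (h2 : v * star v = projInf (1 - p) q) :
    IsGeodesicJoining A p q (orbitCurve (direction p q v) p) where
  geodesic := isGeodesic_orbitCurve hp (direction_mem hp hq hv) (star_direction hp.2 hq.2 h1 h2)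
    (direction_mul_add_mul_direction hp.2 hq.2 h1 h2)
  source := orbitCurve_zero
  target := by rw [orbitCurve_one, exp_direction_conj hp.2 hq.2 h1 h2]

theorem isNormalizedCurve_direction (hp : IsStarProjection p) (hq : IsStarProjection q)
    (h1 : star v * v = projInf p (1 - q)) (h2 : v * star v = projInf (1 - p) q) :
    IsNormalizedCurve (orbitCurve (direction p q v) p) := by
  rw [IsNormalizedCurve, norm_deriv_orbitCurve hp (star_direction hp hq h1 h2)
    (direction_mul_add_mul_direction hp hq h1 h2)]
  exact (norm_direction_le hp hq h1 h2).trans norm_angle_le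

theorem isLengthMinimizing_direction (hp : p ∈ projectionSet A) (hq : q ∈ projectionSet A)
    (h1 : star v * v = projInf p (1 - q)) (h2 : v * star v = projInf (1 - p) q) :
    IsLengthMinimizing A (orbitCurve (direction p q v) p) := by
  intro γ a b hab hγ hmem ha hb
  rw [orbitCurve_zero] at ha
  rw [orbitCurve_one, exp_direction_conj hp.2 hq.2 h1 h2] at hb
  rw [curveLength_orbitCurve hp.2 (star_direction hp.2 hq.2 h1 h2)
    (direction_mul_add_mul_direction hp.2 hq.2 h1 h2)]
  have h := arcsin_norm_sub_le_curveLength hab hγ fun t ht => (hmem t ht).2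
  rw [ha, hb] at h
  exact ((norm_direction_le hp.2 hq.2 h1 h2).trans norm_angle_le_arcsin_norm).trans h

/-- The geodesics defined by `v` and `-v` differ unless `v = 0`. -/
theorem eq_zero_of_orbitCurve_direction_eq (hp : IsStarProjection p) (hq : IsStarProjection q)
    (h1 : star v * v = projInf p (1 - q)) (h2 : v * star v = projInf (1 - p) q)
    (h : orbitCurve (direction p q v) p = orbitCurve (direction p q (-v)) p) : v = 0 := by
  have h1' : star (-v) * -v = projInf p (1 - q) := by rw [star_neg, neg_mul_neg, h1]
  have h2' : -v * star (-v) = projInf (1 - p) q := by rw [star_neg, neg_mul_neg, h2]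
  have hz := eq_of_orbitCurve_eq hp (direction_mul_add_mul_direction hp hq h1 h2)
    (direction_mul_add_mul_direction hp hq h1' h2') h
  have hS := congrArg NormedSpace.exp hz
  rw [exp_direction hp hq h1 h2, exp_direction hp hq h1' h2'] at hS
  have hS' := congrArg (· * (2 * p - 1)) hS
  simp only [mul_assoc, symmetry_mul_self hp, mul_one, exchange, star_neg] at hS'
  have hv : v + star v = 0 := by
    refine smul_right_injective _ (two_ne_zero' ℂ) ?_
    linear_combination (norm := module) hS'
  obtain ⟨-, hqv, -, hvq⟩ := projections_mul_partialIsometry hp hq h1 h2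
  have hvq' := congrArg star hvq
  rw [star_mul, hq.isSelfAdjoint.star_eq, star_zero] at hvq'
  simpa [mul_add, hqv, hvq'] using congrArg (q * ·) hv

end Main

theorem mainTheorem1 {H : Type*} [NormedAddCommGroup H] [InnerProductSpace ℂ H] [CompleteSpace H]
    (A : VonNeumannAlgebra H) (p q : H →L[ℂ] H)
    (hp : p ∈ projectionSet A) (hq : q ∈ projectionSet A) :
    ((∃ δ, IsGeodesicJoining A p q δ) ↔ MvNEquiv A (projInf p (1 - q)) (projInf (1 - p) q)) ∧
    (MvNEquiv A (projInf p (1 - q)) (projInf (1 - p) q) →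
      ∃ δ, IsGeodesicJoining A p q δ ∧ IsNormalizedCurve δ ∧ IsLengthMinimizing A δ) ∧
    ((∃! δ, IsGeodesicJoining A p q δ ∧ IsNormalizedCurve δ) ↔
      projInf p (1 - q) = 0 ∧ projInf (1 - p) q = 0) := by
  have hgen {δ : ℝ → H →L[ℂ] H} (hδ : IsGeodesicJoining A p q δ) :
      ∃ z ∈ A, star z = -z ∧ z * p + p * z = z ∧ δ = orbitCurve z p ∧
        NormedSpace.exp z * p * NormedSpace.exp (-z) = q := by
    obtain ⟨z, hzA, hz, h, hδz⟩ := hδ.geodesic.exists_eq_orbitCurve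
    rw [hδ.source] at h hδz
    exact ⟨z, hzA, hz, h, hδz, by rw [← orbitCurve_one, ← hδz, hδ.target]⟩
  have hmvn : (∃ δ, IsGeodesicJoining A p q δ) →
      MvNEquiv A (projInf p (1 - q)) (projInf (1 - p) q) := by
    rintro ⟨δ, hδ⟩
    obtain ⟨z, hzA, hz, h, -, hpq⟩ := hgen hδ
    exact mvNEquiv_of_exp_conj hp hq hzA hz h hpq
  have hmin : MvNEquiv A (projInf p (1 - q)) (projInf (1 - p) q) →
      ∃ δ, IsGeodesicJoining A p q δ ∧ IsNormalizedCurve δ ∧ IsLengthMinimizing A δ := by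
    rintro ⟨v, hv, h1, h2⟩
    exact ⟨_, isGeodesicJoining_direction hp hq hv h1 h2,
      isNormalizedCurve_direction hp.2 hq.2 h1 h2, isLengthMinimizing_direction hp hq h1 h2⟩
  refine ⟨⟨hmvn, fun h => ?_⟩, hmin, ⟨?_, ?_⟩⟩
  · obtain ⟨δ, hδ, -⟩ := hmin h
    exact ⟨δ, hδ⟩
  · rintro ⟨δ, ⟨hδ, -⟩, huniq⟩
    obtain ⟨v, hv, h1, h2⟩ := hmvn ⟨δ, hδ⟩
    have h1' : star (-v) * -v = projInf p (1 - q) := by rw [star_neg, neg_mul_neg, h1]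
    have h2' : -v * star (-v) = projInf (1 - p) q := by rw [star_neg, neg_mul_neg, h2]
    have hv0 : v = 0 := eq_zero_of_orbitCurve_direction_eq hp.2 hq.2 h1 h2
      ((huniq _ ⟨isGeodesicJoining_direction hp hq hv h1 h2,
        isNormalizedCurve_direction hp.2 hq.2 h1 h2⟩).trans
      (huniq _ ⟨isGeodesicJoining_direction hp hq (neg_mem hv) h1' h2',
        isNormalizedCurve_direction hp.2 hq.2 h1' h2'⟩).symm)
    exact ⟨by rw [← h1, hv0, mul_zero], by rw [← h2, hv0, zero_mul]⟩
  · rintro ⟨he, hf⟩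
    obtain ⟨δ, hδ, hδn, -⟩ := hmin ⟨0, zero_mem A, by rw [mul_zero, he], by rw [zero_mul, hf]⟩
    refine ⟨δ, ⟨hδ, hδn⟩, ?_⟩
    rintro δ' ⟨hδ', hδn'⟩
    obtain ⟨z, -, hz, h, rfl, hpq⟩ := hgen hδ
    obtain ⟨z', -, hz', h', rfl, hpq'⟩ := hgen hδ'
    rw [IsNormalizedCurve, norm_deriv_orbitCurve hp.2 hz h] at hδn
    rw [IsNormalizedCurve, norm_deriv_orbitCurve hp.2 hz' h'] at hδn'
    rw [generator_unique hp.2 hq.2 he hf hz hz' h h' hpq hpq' hδn hδn']
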